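/- **Setting.** Names form a countable set containing a special output channel $o$, the natural numbers, and infinitely many further channel names. Processes of the asynchronous $\pi$-calculus $\pi_a$ are given, up to alpha-conversion, by $P ::= \mathbf 0 \mid \bar x y \mid x(y).P \mid \nu x\,P \mid P|P \mid {!P}$. They have the usual early transition semantics with input actions $x(y)$ (the name $y$ is received), free outputs $\bar xy$, bound outputs $\bar x(y)$ and $\tau$, closed under the structural congruence generated by commutativity and associativity of $|$ and scope extrusion. A *network* is $P=P_1|\dots|P_k$ with all $P_i$ in $\pi_a$. A *computation* of $P$ is a finite or infinite sequence of transitions starting from $P$, in which each private name exchanged between components has its restriction moved to the top level of the network. In every transition either one component moves or two different components communicate. The *projection* $\mathrm{Proj}(C,i)$ of a computation $C$ is the sequence of actions that the $i$-th component contributes to $C$. A computation $C'$ *extends* $C$ if $C$ is an initial part of $C'$ (possibly $C'=C$); an infinite computation is extended only by itself. $P$ is an *electoral system* if every computation $C$ of $P$ has an extension $C'$ and there is $n\in\{1,\dots,k\}$ such that for every $i\in\{1,\dots,k\}$ the projection $\mathrm{Proj}(C',i)$ contains an output action $\bar o n$, and no extension of $C'$ contains an action $\bar o m$ with $m\ne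 n$. The hypergraph $H(P)=\langle N,X,t\rangle$ has nodes $N=\{1,\dots,k\}$, arcs $X=\mathrm{fn}(P)\setminus\{o\}$, and $t(x)=\{n\in N : x\in \mathrm{fn}(P_n)\}$. An *automorphism* of $H(P)$ is a pair $\sigma=\langle\sigma_N,\sigma_X\rangle$ of permutations of $N$ and $X$ with $t(\sigma_X(x))=\sigma_N(t(x))$ for all $x\in X$. It is *well-balanced* if all the orbits of $\sigma_N$ on $N$ have the same cardinality. As the numbers $1,\dots,k$ are both nodes and names, $\sigma_N$ and $\sigma_X$ are required to agree on them: $\sigma_X(n)=\sigma_N(n)$ whenever $n\in N\cap X$. $P$ is *symmetric with respect to* $\sigma$ if for every $i\in N$ the process $P_{\sigma_N(i)}$ is alpha-convertible to $\sigma(P_i)$, the process obtained from $P_i$ by renaming its free names by $\sigma_X$ ($o$ being fixed). **Corollary.** Let $P=P_1|\dots|P_k$ be a network in the $\pi_a$-calculus. Assume that $H(P)$ admits a well-balanced automorphism $\sigma=\langle\sigma_N,\sigma_X\rangle\ne\mathrm{id}$, with $\sigma_N$ and $\sigma_X$ agreeing on the node identifiers that occur as arcs, and that $P$ is symmetric with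 respect to $\sigma$. Then $P$ is not an electoral system. -/

import Mathlib

namespace AsyncPi

/-- The countable set of names: the special output channel `o`, the natural numbers (used as
identifiers of the processes of a network), and infinitely many further channel names. -/
inductive Name : Type
  | o : Name
  | num (n : ℕ) : Name
  | chan (n : ℕ) : Name
  deriving DecidableEq

/-- Terms of the asynchronous pi-calculus, up to alpha-conversion, whose free names lie in `V`.
In the scope of a binder the bound name is `none` and every other name `a` is `some a`. Two named
processes are alpha-convertible iff they are the same term. Inaction `nil` is a primitive. -/
inductive Tm : Type → Type 1
  | nil {V : Type} : Tm V
  | out {V : Type} (x y : V) : Tm V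
  | inp {V : Type} (x : V) (P : Tm (Option V)) : Tm V
  | nu {V : Type} (P : Tm (Option V)) : Tm V
  | par {V : Type} (P Q : Tm V) : Tm V
  | rep {V : Type} (P : Tm V) : Tm V

namespace Tm

/-- Renaming of free names (capture is impossible, since bound names are not in `V`). -/
def map : {V W : Type} → (V → W) → Tm V → Tm W
  | _, _, _, nil => nil
  | _, _, f, out x y => out (f x) (f y)
  | _, _, f, inp x P => inp (f x) (map (Option.map f) P)
  | _, _, f, nu P => nu (map (Option.map f) P)
  | _, _, f, par P Q => par (map f P) (map f Q)
  | _, _, f, rep P => rep (map f P)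

/-- The free names of a term. -/
def fn : {V : Type} → Tm V → Set V
  | _, nil => ∅
  | _, out x y => {x, y}
  | _, inp x P => {x} ∪ some ⁻¹' fn P
  | _, nu P => some ⁻¹' fn P
  | _, par P Q => fn P ∪ fn Q
  | _, rep P => fn P

theorem fn_finite {V : Type} (P : Tm V) : P.fn.Finite := by
  induction P with
  | nil => exact Set.finite_empty
  | out x y => exact (Set.finite_singleton y).insert x
  | inp x P ih =>
    exact (Set.finite_singleton x).union (ih.preimage (Option.some_injective _).injOn)
  | nu P ih => exact ih.preimage (Option.some_injective _).injOn
  | par P Q ihP ihQ => exact ihP.union ihQ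
  | rep P ih => exact ih

end Tm

/-- Processes of the asynchronous pi-calculus (up to alpha-conversion). -/
abbrev Proc : Type 1 := Tm Name

namespace Proc

/-- Turns the free name `y` into the name bound by an enclosing binder. -/
def bind (y : Name) (P : Proc) : Tm (Option Name) :=
  Tm.map (fun a => if a = y then none else some a) P

/-- The input prefix `x(y).P`. -/
def input (x y : Name) (P : Proc) : Proc := Tm.inp x (bind y P)

/-- The restriction `νy P`. -/
def res (y : Name) (P : Proc) : Proc := Tm.nu (bind y P)

/-- The capture-avoiding substitution `P{z/y}`. -/
def subst (P : Proc) (z y : Name) : Proc := Tm.map (fun a => if a = y then z else a) P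

end Proc

/-- Structural congruence: the least congruence with commutativity and associativity of parallel
composition and scope extrusion (alpha-convertible processes are already equal). -/
inductive Cong : Proc → Proc → Prop
  | refl (P : Proc) : Cong P P
  | symm {P Q : Proc} : Cong P Q → Cong Q P
  | trans {P Q R : Proc} : Cong P Q → Cong Q R → Cong P R
  | par_comm (P Q : Proc) : Cong (Tm.par P Q) (Tm.par Q P)
  | par_assoc (P Q R : Proc) : Cong (Tm.par (Tm.par P Q) R) (Tm.par P (Tm.par Q R))
  | scope (x : Name) (P Q : Proc) : x ∉ Tm.fn Q →
      Cong (Tm.par (Proc.res x P) Q) (Proc.res x (Tm.par P Q))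
  | input (x y : Name) {P Q : Proc} : Cong P Q → Cong (Proc.input x y P) (Proc.input x y Q)
  | res (y : Name) {P Q : Proc} : Cong P Q → Cong (Proc.res y P) (Proc.res y Q)
  | par {P P' Q Q' : Proc} : Cong P P' → Cong Q Q' → Cong (Tm.par P Q) (Tm.par P' Q')
  | rep {P Q : Proc} : Cong P Q → Cong (Tm.rep P) (Tm.rep Q)

/-- Actions: early input `x(y)` (reception of `y` on `x`), free output, bound output, silent. -/
inductive Action : Type
  | inp (x y : Name) : Action
  | out (x y : Name) : Action
  | bout (x y : Name) : Action
  | tau : Action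

namespace Action

/-- All names of an action. -/
def names : Action → Set Name
  | inp x y => {x, y}
  | out x y => {x, y}
  | bout x y => {x, y}
  | tau => ∅

/-- The bound names of an action. In the early semantics the received name of an input is an
actual name and not a binder, so only a bound output binds. -/
def bn : Action → Set Name
  | bout _ y => {y}
  | _ => ∅

end Action

/-- The early transition system of the asynchronous pi-calculus. -/
inductive Trans : Proc → Action → Proc → Prop
  | inp (x y z : Name) (P : Proc) : Trans (Proc.input x y P) (.inp x z) (Proc.subst P z y)
  | out (x y : Name) : Trans (Tm.out x y) (.out x y) Tm.nil
  | open_ {x y : Name} {P P' : Proc} : Trans P (.out x y) P' → x ≠ y →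
      Trans (Proc.res y P) (.bout x y) P'
  | res {y : Name} {μ : Action} {P P' : Proc} : Trans P μ P' → y ∉ μ.names →
      Trans (Proc.res y P) μ (Proc.res y P')
  | par {μ : Action} {P P' : Proc} (Q : Proc) : Trans P μ P' → Disjoint μ.bn (Tm.fn Q) →
      Trans (Tm.par P Q) μ (Tm.par P' Q)
  | com {x y : Name} {P P' Q Q' : Proc} : Trans P (.inp x y) P' → Trans Q (.out x y) Q' →
      Trans (Tm.par P Q) .tau (Tm.par P' Q')
  | close {x y : Name} {P P' Q Q' : Proc} : Trans P (.inp x y) P' → Trans Q (.bout x y) Q' →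
      y ∉ Tm.fn P → Trans (Tm.par P Q) .tau (Proc.res y (Tm.par P' Q'))
  | rep {μ : Action} {P P' : Proc} : Trans (Tm.par P (Tm.rep P)) μ P' → Trans (Tm.rep P) μ P'
  | cong {μ : Action} {P P' Q Q' : Proc} : Cong P P' → Trans P' μ Q' → Cong Q' Q → Trans P μ Q

/-- A network `P_1 | ... | P_k`. -/
abbrev Network (k : ℕ) : Type 1 := Fin k → Proc

/-- The name that identifies a node: the nodes are numbered `1, ..., k`. -/
def nodeName {k : ℕ} (i : Fin k) : Name := .num (i.val + 1)

/-- A state `ν top (P_1 | ... | P_k)` of a network, where `top` are the restrictions that were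
pushed to the top level. -/
structure State (k : ℕ) where
  top : Finset Name
  comp : Network k

/-- `Step S μ c S'`: the network makes a transition labelled `μ` from `S` to `S'`, and `c i` is the
transition label contributed to it by the `i`-th component (`none` if this component is idle). -/
inductive Step {k : ℕ} : State k → Action → (Fin k → Option Action) → State k → Prop
  /-- One component moves; the action involves no name restricted at the top level. -/
  | par (S : State k) (i : Fin k) (μ : Action) (Q : Proc) :
      Trans (S.comp i) μ Q → (∀ j, j ≠ i → Disjoint μ.bn (Tm.fn (S.comp j))) →
      Disjoint μ.names (S.top : Set Name) →
      Step S μ (Function.update (fun _ => none) i (some μ))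
        ⟨S.top, Function.update S.comp i Q⟩
  /-- One component sends to the environment a name that is restricted at the top level. -/
  | extrude (S : State k) (i : Fin k) (x y : Name) (Q : Proc) :
      Trans (S.comp i) (.out x y) Q → x ∉ S.top → y ∈ S.top →
      Step S (.bout x y) (Function.update (fun _ => none) i (some (.out x y)))
        ⟨S.top.erase y, Function.update S.comp i Q⟩
  /-- Component `j` sends a name to component `i`. -/
  | com (S : State k) (i j : Fin k) (x y : Name) (Q R : Proc) : i ≠ j →
      Trans (S.comp i) (.inp x y) Q → Trans (S.comp j) (.out x y) R →
      Step S .tau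
        (Function.update (Function.update (fun _ => none) i (some (.inp x y))) j
          (some (.out x y)))
        ⟨S.top, Function.update (Function.update S.comp i Q) j R⟩
  /-- Component `j` sends a private name to component `i`; the new restriction is pushed to the
  top level. -/
  | close (S : State k) (i j : Fin k) (x y : Name) (Q R : Proc) : i ≠ j →
      Trans (S.comp i) (.inp x y) Q → Trans (S.comp j) (.bout x y) R →
      (∀ l, y ∉ Tm.fn (S.comp l)) → y ∉ S.top →
      Step S .tau
        (Function.update (Function.update (fun _ => none) i (some (.inp x y))) j
          (some (.bout x y)))
        ⟨insert y S.top, Function.update (Function.update S.comp i Q) j R⟩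

/-- A finite or infinite computation of the network `P`, with `len` transitions. The values of
`state` beyond `len`, and of `label` and `contrib` from `len` on, carry no meaning. -/
structure Computation {k : ℕ} (P : Network k) where
  len : ℕ∞
  state : ℕ → State k
  label : ℕ → Action
  contrib : ℕ → Fin k → Option Action
  start : state 0 = ⟨∅, P⟩
  step : ∀ m : ℕ, (m : ℕ∞) < len → Step (state m) (label m) (contrib m) (state (m + 1))

namespace Computation

variable {k : ℕ} {P : Network k}

/-- `C'` extends `C` (not necessarily strictly). -/
def Extends (C C' : Computation P) : Prop :=
  C.len ≤ C'.len ∧ (∀ m : ℕ, (m : ℕ∞) ≤ C.len → C'.state m = C.state m) ∧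
    ∀ m : ℕ, (m : ℕ∞) < C.len → C'.label m = C.label m ∧ C'.contrib m = C.contrib m

/-- The action `μ` occurs in the computation, as the label of a transition of the network. -/
def Contains (C : Computation P) (μ : Action) : Prop :=
  ∃ m : ℕ, (m : ℕ∞) < C.len ∧ C.label m = μ

/-- The action `μ` occurs in the projection of the computation over the `i`-th component. -/
def ProjContains (C : Computation P) (i : Fin k) (μ : Action) : Prop :=
  ∃ m : ℕ, (m : ℕ∞) < C.len ∧ C.contrib m i = some μ

end Computation

/-- Electoral systems. -/
def IsElectoral {k : ℕ} (P : Network k) : Prop :=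
  ∀ C : Computation P, ∃ C' : Computation P, C.Extends C' ∧ ∃ n : Fin k,
    (∀ i : Fin k, C'.ProjContains i (.out .o (nodeName n))) ∧
    ∀ C'' : Computation P, C'.Extends C'' → ∀ m : Name, C''.Contains (.out .o m) → m = nodeName n

/-- Hypergraphs with finitely many nodes and arcs. -/
structure Hypergraph where
  N : Type
  X : Type
  finite_N : Finite N
  finite_X : Finite X
  t : X → Set N

/-- Automorphisms of a hypergraph. -/
@[ext]
structure Hypergraph.Aut (H : Hypergraph) where
  onN : Equiv.Perm H.N
  onX : Equiv.Perm H.X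
  type_map : ∀ x, H.t (onX x) = onN '' H.t x

namespace Hypergraph.Aut

variable {H : Hypergraph}

/-- The identity automorphism. -/
def id (H : Hypergraph) : H.Aut where
  onN := 1
  onX := 1
  type_map x := by simp

/-- The orbit of a node. -/
def orbit (σ : H.Aut) (n : H.N) : Set H.N := {m | ∃ i : ℕ, m = (σ.onN ^ i) n}

/-- All orbits (of nodes) have the same cardinality. -/
def WellBalanced (σ : H.Aut) : Prop := ∀ m n : H.N, (σ.orbit m).ncard = (σ.orbit n).ncard

end Hypergraph.Aut

namespace Network

variable {k : ℕ}

/-- The arcs of the associated hypergraph: the free names of the network, except `o`. -/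
def arcs (P : Network k) : Set Name := (⋃ i, Tm.fn (P i)) \ {Name.o}

theorem arcs_finite (P : Network k) : P.arcs.Finite :=
  (Set.finite_iUnion fun i => (P i).fn_finite).subset Set.sdiff_subset

/-- The hypergraph `H(P)` associated to a network. -/
def hypergraph (P : Network k) : Hypergraph where
  N := Fin k
  X := P.arcs
  finite_N := inferInstance
  finite_X := P.arcs_finite
  t x := {n | (x : Name) ∈ Tm.fn (P n)}

open Classical in
/-- The action of an automorphism on names: that of `onX` on the arcs, the identity elsewhere. -/
noncomputable def rename (P : Network k) (σ : P.hypergraph.Aut) (a : Name) : Name :=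
  if h : a ∈ P.arcs then Subtype.val (p := (· ∈ P.arcs)) (σ.onX ⟨a, h⟩) else a

/-- An arc that is the identifier of a node is moved as this node is. -/
def RespectsIdentifiers (P : Network k) (σ : P.hypergraph.Aut) : Prop :=
  ∀ n : Fin k, nodeName n ∈ P.arcs → P.rename σ (nodeName n) = nodeName (k := k) (σ.onN n)

/-- `P` is symmetric with respect to `σ`: for each node `i`, the process at `σ(i)` is the
`σ`-renaming of the process at `i` (up to alpha-conversion, which is equality of terms). -/
def SymmetricWrt (P : Network k) (σ : P.hypergraph.Aut) : Prop :=
  ∀ i : Fin k, P (σ.onN i) = Tm.map (P.rename σ) (P i)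

end Network

end AsyncPi

/-! Nothing in the calculus forces a symmetry to be broken. From a state invariant under the
rotation induced by `σ`, any possible transition can be followed by all its rotated copies, one turn
after another, and this round ends in an invariant state. The obstacle is a component that occurs in
two turns, once as sender and once as receiver. No process offers a choice between an output and an
input: the two stem from parallel parts, so they commute (`Trans.out_inp_diamond`,
`Trans.bout_inp_diamond`), and the order of the two roles is irrelevant.

Well-balancedness makes the rotation free (`Network.exists_rotation`): a power of `σ` that fixes one
node fixes all nodes, hence by symmetry each process, hence each arc. Rotating a process along an
orbit is therefore well defined, and within a round each role falls to distinct nodes. Since `σ` is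
not the identity, no node is fixed.

If an invariant state could declare a leader, the rotated component could then declare a different
one (`Rotation.Symmetric.exists_conflict`), which no electoral system survives. So invariant states
reached without a declaration offer none, and neither does a round, whose labels are all offered by
its initial state. As the leader is still to be declared, the system must be able to move, and
another round follows (`IsElectoral.exists_next`). Iteration gives an infinite computation without a
declaration, and it has no proper extension.

Commutation is hard to read off `Trans`, which is closed under structural congruence. Visible
transitions are therefore derived again without congruence on scoped terms (`FTrans`, `BTrans`), and
congruence is shown to be a bisimulation for them (`TCong.sim`, `Trans.raw`). -/

namespace AsyncPi

/-! ### Renaming and free names of scoped terms. -/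

namespace Tm

theorem map_map {U : Type} (P : Tm U) : ∀ {V W : Type} (f : U → V) (g : V → W),
    map g (map f P) = map (g ∘ f) P := by
  induction P with
  | nil => intros; rfl
  | out x y => intros; rfl
  | inp x P ih => intro V W f g; simp [map, ih, Option.map_comp_map]
  | nu P ih => intro V W f g; simp [map, ih, Option.map_comp_map]
  | par P Q ihP ihQ => intro V W f g; simp [map, ihP, ihQ]
  | rep P ih => intro V W f g; simp [map, ih]

theorem map_congr {U : Type} (P : Tm U) : ∀ {V : Type} {f g : U → V},
    (∀ a ∈ fn P, f a = g a) → map f P = map g P := by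
  induction P with
  | nil => intros; rfl
  | out x y => intro V f g h; simp [map, h x (by simp [fn]), h y (by simp [fn])]
  | inp x P ih =>
    intro V f g h
    simp only [map, h x (by simp [fn])]
    rw [ih]
    rintro (_ | a) ha
    · rfl
    · simp [h a (by simp [fn, ha])]
  | nu P ih =>
    intro V f g h
    simp only [map]
    rw [ih]
    rintro (_ | a) ha
    · rfl
    · simp [h a (by simp [fn, ha])]
  | par P Q ihP ihQ =>
    intro V f g h
    simp only [map]
    rw [ihP fun a ha => h a (by simp [fn, ha]), ihQ fun a ha => h a (by simp [fn, ha])]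
  | rep P ih => intro V f g h; simp only [map]; rw [ih h]

theorem map_id {U : Type} (P : Tm U) : map id P = P := by
  induction P with
  | nil => rfl
  | out x y => rfl
  | inp x P ih => simp [map, ih]
  | nu P ih => simp [map, ih]
  | par P Q ihP ihQ => simp [map, ihP, ihQ]
  | rep P ih => simp [map, ih]

theorem map_of_fixed {U : Type} {P : Tm U} {f : U → U} (h : ∀ a ∈ fn P, f a = a) :
    map f P = P :=
  (map_congr P h).trans (map_id P)

/-- Equality of terms compares every free occurrence with its image. This turns symmetry of
processes into information on names: a power of the automorphism that fixes a process fixes its free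
names. -/
theorem fixed_of_map {U : Type} (P : Tm U) : ∀ {f : U → U}, map f P = P →
    ∀ a ∈ fn P, f a = a := by
  induction P with
  | nil => intro f _ a ha; simp [fn] at ha
  | out x y =>
    intro f h a ha
    simp only [map, out.injEq] at h
    simp only [fn, Set.mem_insert_iff, Set.mem_singleton_iff] at ha
    rcases ha with rfl | rfl
    exacts [h.1, h.2]
  | inp x P ih =>
    intro f h a ha
    simp only [map, inp.injEq] at h
    rcases ha with rfl | ha
    · exact h.1
    · simpa using ih h.2 (some a) ha
  | nu P ih =>
    intro f h a ha
    simp only [map, nu.injEq] at h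
    simpa using ih h (some a) ha
  | par P Q ihP ihQ =>
    intro f h a ha
    simp only [map, par.injEq] at h
    rcases ha with ha | ha
    exacts [ihP h.1 a ha, ihQ h.2 a ha]
  | rep P ih =>
    intro f h a ha
    simp only [map, rep.injEq] at h
    exact ih h a ha

theorem preimage_some_image {U V : Type} (f : U → V) (s : Set (Option U)) :
    some ⁻¹' (Option.map f '' s) = f '' (some ⁻¹' s) := by
  ext b
  constructor
  · rintro ⟨_ | a, ha, h⟩
    · simp at h
    · exact ⟨a, ha, by simpa using h⟩
  · rintro ⟨a, ha, rfl⟩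
    exact ⟨some a, ha, rfl⟩

theorem fn_map {U : Type} (P : Tm U) : ∀ {V : Type} (f : U → V), fn (map f P) = f '' fn P := by
  induction P with
  | nil => intro V f; simp [map, fn]
  | out x y => intro V f; simp [map, fn, Set.image_insert_eq]
  | inp x P ih =>
    intro V f
    simp only [map, fn, ih, preimage_some_image, Set.image_union, Set.image_singleton]
  | nu P ih => intro V f; simp only [map, fn, ih, preimage_some_image]
  | par P Q ihP ihQ => intro V f; simp only [map, fn, ihP, ihQ, Set.image_union]
  | rep P ih => intro V f; simp only [map, fn, ih]

/-- Instantiates the name bound by the nearest binder. -/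
def inst {V W : Type} (f : V → W) (z : W) : Option V → W
  | none => z
  | some a => f a

/-- Exchanges the names bound by the two nearest binders. -/
def swap {V : Type} : Option (Option V) → Option (Option V)
  | none => some none
  | some none => none
  | some (some a) => some (some a)

/-! ### Structural congruence and visible transitions over arbitrary name sets. -/

/-- Structural congruence on terms over any set of names. -/
inductive TCong : {V : Type} → Tm V → Tm V → Prop
  | refl {V : Type} (P : Tm V) : TCong P P
  | symm {V : Type} {P Q : Tm V} : TCong P Q → TCong Q P
  | trans {V : Type} {P Q R : Tm V} : TCong P Q → TCong Q R → TCong P R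
  | par_comm {V : Type} (P Q : Tm V) : TCong (par P Q) (par Q P)
  | par_assoc {V : Type} (P Q R : Tm V) : TCong (par (par P Q) R) (par P (par Q R))
  | scope {V : Type} (P : Tm (Option V)) (Q : Tm V) :
      TCong (par (nu P) Q) (nu (par P (map some Q)))
  | inp {V : Type} (x : V) {P Q : Tm (Option V)} : TCong P Q → TCong (inp x P) (inp x Q)
  | nu {V : Type} {P Q : Tm (Option V)} : TCong P Q → TCong (nu P) (nu Q)
  | par {V : Type} {P P' Q Q' : Tm V} : TCong P P' → TCong Q Q' → TCong (par P Q) (par P' Q')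
  | rep {V : Type} {P Q : Tm V} : TCong P Q → TCong (rep P) (rep Q)

theorem TCong.map {V : Type} {P Q : Tm V} (h : TCong P Q) :
    ∀ {W : Type} (f : V → W), TCong (map f P) (map f Q) := by
  induction h with
  | refl P => intro W f; exact .refl _
  | symm _ ih => intro W f; exact (ih f).symm
  | trans _ _ ih₁ ih₂ => intro W f; exact (ih₁ f).trans (ih₂ f)
  | par_comm P Q => intro W f; exact .par_comm _ _
  | par_assoc P Q R => intro W f; exact .par_assoc _ _ _
  | scope P Q =>
    intro W f
    have := TCong.scope (Tm.map (Option.map f) P) (Tm.map f Q)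
    simp only [Tm.map, map_map] at this ⊢
    exact this
  | inp x _ ih => intro W f; exact .inp _ (ih _)
  | nu _ ih => intro W f; exact .nu (ih _)
  | par _ _ ih₁ ih₂ => intro W f; exact .par (ih₁ f) (ih₂ f)
  | rep _ ih => intro W f; exact .rep (ih f)

/-- Transitions by free outputs (`true`) and early inputs (`false`), derived without
structural congruence. -/
inductive FTrans : {V : Type} → Bool → V → V → Tm V → Tm V → Prop
  | out {V : Type} (x y : V) : FTrans true x y (out x y) nil
  | inp {V : Type} (x z : V) (P : Tm (Option V)) :
      FTrans false x z (inp x P) (map (inst _root_.id z) P)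
  | parL {V : Type} {d : Bool} {x y : V} {P P' : Tm V} (Q : Tm V) :
      FTrans d x y P P' → FTrans d x y (par P Q) (par P' Q)
  | parR {V : Type} {d : Bool} {x y : V} (P : Tm V) {Q Q' : Tm V} :
      FTrans d x y Q Q' → FTrans d x y (par P Q) (par P Q')
  | nu {V : Type} {d : Bool} {x y : V} {P P' : Tm (Option V)} :
      FTrans d (some x) (some y) P P' → FTrans d x y (nu P) (nu P')
  | repL {V : Type} {d : Bool} {x y : V} {P P' : Tm V} :
      FTrans d x y P P' → FTrans d x y (rep P) (par P' (rep P))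
  | repR {V : Type} {d : Bool} {x y : V} {P P' : Tm V} :
      FTrans d x y (rep P) P' → FTrans d x y (rep P) (par P P')

/-- Transitions by bound outputs, derived without structural congruence. In the target the
extruded name is `none`. -/
inductive BTrans : {V : Type} → V → Tm V → Tm (Option V) → Prop
  | open_ {V : Type} {x : V} {P P' : Tm (Option V)} :
      FTrans true (some x) none P P' → BTrans x (nu P) P'
  | parL {V : Type} {x : V} {P : Tm V} {P' : Tm (Option V)} (Q : Tm V) :
      BTrans x P P' → BTrans x (par P Q) (par P' (map some Q))
  | parR {V : Type} {x : V} (P : Tm V) {Q : Tm V} {Q' : Tm (Option V)} :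
      BTrans x Q Q' → BTrans x (par P Q) (par (map some P) Q')
  | nu {V : Type} {x : V} {P : Tm (Option V)} {P' : Tm (Option (Option V))} :
      BTrans (some x) P P' → BTrans x (nu P) (nu (map swap P'))
  | repL {V : Type} {x : V} {P : Tm V} {P' : Tm (Option V)} :
      BTrans x P P' → BTrans x (rep P) (par P' (map some (rep P)))
  | repR {V : Type} {x : V} {P : Tm V} {P' : Tm (Option V)} :
      BTrans x (rep P) P' → BTrans x (rep P) (par (map some P) P')

theorem comp_inst_id {V W : Type} (f : V → W) (z : V) :
    f ∘ inst _root_.id z = inst _root_.id (f z) ∘ Option.map f := by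
  funext a; cases a <;> rfl

theorem swap_comp_map {V W : Type} (f : V → W) :
    swap ∘ Option.map (Option.map f) = Option.map (Option.map f) ∘ swap := by
  funext a; rcases a with _ | _ | a <;> rfl

theorem FTrans.map {V : Type} {d : Bool} {x y : V} {P P' : Tm V} (h : FTrans d x y P P') :
    ∀ {W : Type} (f : V → W), FTrans d (f x) (f y) (map f P) (map f P') := by
  induction h with
  | out x y => intro W f; exact .out _ _
  | inp x z P =>
    intro W f
    rw [map_map, comp_inst_id, ← map_map]
    exact .inp _ _ _
  | parL Q _ ih => intro W f; exact .parL _ (ih f)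
  | parR P _ ih => intro W f; exact .parR _ (ih f)
  | nu _ ih => intro W f; exact .nu (ih (Option.map f))
  | repL _ ih => intro W f; exact .repL (ih f)
  | repR _ ih => intro W f; exact .repR (ih f)

theorem map_map_some {V W : Type} (f : V → W) (P : Tm V) :
    map (Option.map f) (map some P) = map some (map f P) := by
  rw [map_map, map_map]; rfl

theorem BTrans.map {V : Type} {x : V} {P : Tm V} {P' : Tm (Option V)} (h : BTrans x P P') :
    ∀ {W : Type} (f : V → W), BTrans (f x) (map f P) (map (Option.map f) P') := by
  induction h with
  | open_ h => intro W f; exact .open_ (h.map (Option.map f))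
  | parL Q _ ih => intro W f; have := BTrans.parL (Tm.map f Q) (ih f); rwa [← map_map_some] at this
  | parR P _ ih => intro W f; have := BTrans.parR (Tm.map f P) (ih f); rwa [← map_map_some] at this
  | nu _ ih =>
    intro W f
    have := BTrans.nu (ih (Option.map f))
    rwa [map_map, swap_comp_map, ← map_map] at this
  | @repL _ _ P _ _ ih =>
    intro W f
    have := BTrans.repL (ih f)
    change BTrans _ _ (Tm.par _ (Tm.map (Option.map f) (Tm.map some P.rep)))
    rw [map_map_some]
    exact this
  | repR _ ih => intro W f; have := BTrans.repR (ih f); rwa [← map_map_some] at this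

theorem FTrans.mem_fn {V : Type} {d : Bool} {x y : V} {P P' : Tm V} (h : FTrans d x y P P') :
    x ∈ fn P ∧ (d = true → y ∈ fn P) := by
  induction h with
  | out x y => simp [fn]
  | inp x z P => simp [fn]
  | parL Q _ ih => exact ⟨.inl ih.1, fun h => .inl (ih.2 h)⟩
  | parR P _ ih => exact ⟨.inr ih.1, fun h => .inr (ih.2 h)⟩
  | nu _ ih => exact ih
  | repL _ ih => exact ih
  | repR _ ih => exact ih

theorem none_notMem_fn_map_some {V : Type} (P : Tm V) : none ∉ fn (map some P) := by
  simp [fn_map]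

/-! ### Commutation of outputs with inputs. -/

/-- Output and input of the same process commute. -/
theorem FTrans.diamond {V : Type} {x y : V} {P Q : Tm V} {d : Bool} (h : FTrans d x y P Q) :
    d = true → ∀ {x' z : V} {R : Tm V}, FTrans false x' z P R →
    ∃ T, FTrans false x' z Q T ∧ FTrans true x y R T := by
  induction h with
  -- The absence of choice enters here: a process that is itself an output offers no input, so the
  -- two moves always come from different parallel parts.
  | out x y => intro _ x' z R h'; cases h'
  | inp => intro h; cases h
  | parL Q h ih =>
    rintro rfl x' z R h'
    cases h' with
    | parL _ h' => obtain ⟨T, h₁, h₂⟩ := ih rfl h'; exact ⟨_, .parL _ h₁, .parL _ h₂⟩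
    | parR _ h' => exact ⟨_, .parR _ h', .parL _ h⟩
  | parR P h ih =>
    rintro rfl x' z R h'
    cases h' with
    | parR _ h' => obtain ⟨T, h₁, h₂⟩ := ih rfl h'; exact ⟨_, .parR _ h₁, .parR _ h₂⟩
    | parL _ h' => exact ⟨_, .parL _ h', .parR _ h⟩
  | nu h ih =>
    rintro rfl x' z R h'
    cases h' with
    | nu h' => obtain ⟨T, h₁, h₂⟩ := ih rfl h'; exact ⟨_, .nu h₁, .nu h₂⟩
  | repL h ih =>
    rintro rfl x' z R h'
    cases h' with
    | repL h' => obtain ⟨T, h₁, h₂⟩ := ih rfl h'; exact ⟨_, .parL _ h₁, .parL _ h₂⟩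
    | repR h' => exact ⟨_, .parR _ h', .parL _ h⟩
  | repR h ih =>
    rintro rfl x' z R h'
    cases h' with
    | repR h' => obtain ⟨T, h₁, h₂⟩ := ih rfl h'; exact ⟨_, .parR _ h₁, .parR _ h₂⟩
    | repL h' => exact ⟨_, .parL _ h', .parR _ h⟩

/-- Bound output and input of the same process commute. -/
theorem BTrans.diamond {V : Type} {x : V} {P : Tm V} {Q : Tm (Option V)} (h : BTrans x P Q) :
    ∀ {x' z : V} {R : Tm V}, FTrans false x' z P R →
    ∃ T, FTrans false (some x') (some z) Q T ∧ BTrans x R T := by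
  induction h with
  | open_ h =>
    intro x' z R h'
    cases h' with
    | nu h' => obtain ⟨T, h₁, h₂⟩ := h.diamond rfl h'; exact ⟨_, h₁, .open_ h₂⟩
  | parL Q h ih =>
    intro x' z R h'
    cases h' with
    | parL _ h' => obtain ⟨T, h₁, h₂⟩ := ih h'; exact ⟨_, .parL _ h₁, .parL _ h₂⟩
    | parR _ h' => exact ⟨_, .parR _ (h'.map some), .parL _ h⟩
  | parR P h ih =>
    intro x' z R h'
    cases h' with
    | parR _ h' => obtain ⟨T, h₁, h₂⟩ := ih h'; exact ⟨_, .parR _ h₁, .parR _ h₂⟩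
    | parL _ h' => exact ⟨_, .parL _ (h'.map some), .parR _ h⟩
  | nu h ih =>
    intro x' z R h'
    cases h' with
    | nu h' => obtain ⟨T, h₁, h₂⟩ := ih h'; exact ⟨_, .nu (h₁.map swap), .nu h₂⟩
  | repL h ih =>
    intro x' z R h'
    cases h' with
    | repL h' => obtain ⟨T, h₁, h₂⟩ := ih h'; exact ⟨_, .parL _ h₁, .parL _ h₂⟩
    | repR h' => exact ⟨_, .parR _ (h'.map some), .parL _ h⟩
  | repR h ih =>
    intro x' z R h'
    cases h' with
    | repR h' => obtain ⟨T, h₁, h₂⟩ := ih h'; exact ⟨_, .parR _ h₁, .parR _ h₂⟩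
    | repL h' => exact ⟨_, .parL _ (h'.map some), .parR _ h⟩

/-- Transitions of a renamed term are renamed transitions. -/
theorem FTrans.of_map {V W : Type} {f : V → W} (hf : f.Injective) {d : Bool} {x y : V}
    {P : Tm V} {R : Tm W} (h : FTrans d (f x) (f y) (Tm.map f P) R) :
    ∃ P', FTrans d x y P P' ∧ R = Tm.map f P' := by
  generalize hx : f x = fx at h
  generalize hy : f y = fy at h
  generalize hP : Tm.map f P = fP at h
  induction h generalizing V with
  | out a b =>
    cases P <;> simp only [Tm.map, reduceCtorEq, Tm.out.injEq] at hP
    obtain ⟨rfl, rfl⟩ := hP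
    obtain rfl := hf hx
    obtain rfl := hf hy
    exact ⟨_, .out _ _, rfl⟩
  | inp a b P₀ =>
    cases P <;> simp only [Tm.map, reduceCtorEq, Tm.inp.injEq] at hP
    obtain ⟨rfl, rfl⟩ := hP
    obtain rfl := hf hx
    obtain rfl := hy
    refine ⟨_, .inp _ _ _, ?_⟩
    rw [map_map, map_map, comp_inst_id]
  | parL Q _ ih =>
    cases P <;> simp only [Tm.map, reduceCtorEq, Tm.par.injEq] at hP
    obtain ⟨rfl, rfl⟩ := hP
    obtain ⟨P', h, rfl⟩ := ih hf hx hy rfl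
    exact ⟨_, .parL _ h, rfl⟩
  | parR Q _ ih =>
    cases P <;> simp only [Tm.map, reduceCtorEq, Tm.par.injEq] at hP
    obtain ⟨rfl, rfl⟩ := hP
    obtain ⟨P', h, rfl⟩ := ih hf hx hy rfl
    exact ⟨_, .parR _ h, rfl⟩
  | nu _ ih =>
    cases P <;> simp only [Tm.map, reduceCtorEq, Tm.nu.injEq] at hP
    obtain rfl := hP
    obtain ⟨P', h, rfl⟩ := ih (x := some x) (y := some y) (Option.map_injective hf)
      (by simp [hx]) (by simp [hy]) rfl
    exact ⟨_, .nu h, rfl⟩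
  | repL _ ih =>
    cases P <;> simp only [Tm.map, reduceCtorEq, Tm.rep.injEq] at hP
    obtain rfl := hP
    obtain ⟨P', h, rfl⟩ := ih hf hx hy rfl
    exact ⟨_, .repL h, rfl⟩
  | repR _ ih =>
    cases P <;> simp only [Tm.map, reduceCtorEq, Tm.rep.injEq] at hP
    rename_i P₀
    obtain rfl := hP
    obtain ⟨P', h, rfl⟩ := ih (P := Tm.rep P₀) hf hx hy rfl
    exact ⟨_, .repR h, rfl⟩

theorem BTrans.of_map {V W : Type} {f : V → W} (hf : f.Injective) {x : V}
    {P : Tm V} {R : Tm (Option W)} (h : BTrans (f x) (Tm.map f P) R) :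
    ∃ P', BTrans x P P' ∧ R = Tm.map (Option.map f) P' := by
  generalize hx : f x = fx at h
  generalize hP : Tm.map f P = fP at h
  induction h generalizing V with
  | open_ h =>
    cases P <;> simp only [Tm.map, reduceCtorEq, Tm.nu.injEq] at hP
    subst hP
    subst hx
    obtain ⟨P', h₁, rfl⟩ := FTrans.of_map (x := some x) (y := none) (Option.map_injective hf) h
    exact ⟨_, .open_ h₁, rfl⟩
  | parL Q _ ih =>
    cases P <;> simp only [Tm.map, reduceCtorEq, Tm.par.injEq] at hP
    obtain ⟨rfl, rfl⟩ := hP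
    obtain ⟨P', h, rfl⟩ := ih hf hx rfl
    exact ⟨_, .parL _ h, by rw [Tm.map, map_map_some]⟩
  | parR Q _ ih =>
    cases P <;> simp only [Tm.map, reduceCtorEq, Tm.par.injEq] at hP
    obtain ⟨rfl, rfl⟩ := hP
    obtain ⟨P', h, rfl⟩ := ih hf hx rfl
    exact ⟨_, .parR _ h, by rw [Tm.map, map_map_some]⟩
  | nu _ ih =>
    cases P <;> simp only [Tm.map, reduceCtorEq, Tm.nu.injEq] at hP
    obtain rfl := hP
    obtain ⟨P', h, rfl⟩ := ih (x := some x) (Option.map_injective hf) (by simp [hx]) rfl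
    refine ⟨_, .nu h, ?_⟩
    rw [Tm.map, map_map, map_map, swap_comp_map]
  | repL _ ih =>
    cases P <;> simp only [Tm.map, reduceCtorEq, Tm.rep.injEq] at hP
    obtain rfl := hP
    obtain ⟨P', h, rfl⟩ := ih hf hx rfl
    exact ⟨_, .repL h, by rw [Tm.map, map_map_some]; rfl⟩
  | repR _ ih =>
    cases P <;> simp only [Tm.map, reduceCtorEq, Tm.rep.injEq] at hP
    rename_i P₀
    obtain rfl := hP
    obtain ⟨P', h, rfl⟩ := ih (P := Tm.rep P₀) hf hx rfl
    exact ⟨_, .repR h, by rw [Tm.map, map_map_some]⟩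

/-! ### Structural congruence as a bisimulation. -/

/-- `Q` simulates the transitions of `P`, up to structural congruence. -/
def Sim {V : Type} (P Q : Tm V) : Prop :=
  (∀ d x y P', FTrans d x y P P' → ∃ Q', FTrans d x y Q Q' ∧ TCong P' Q') ∧
  ∀ x P', BTrans x P P' → ∃ Q', BTrans x Q Q' ∧ TCong P' Q'

theorem Sim.trans {V : Type} {P Q R : Tm V} (h : Sim P Q) (h' : Sim Q R) : Sim P R := by
  constructor
  · intro d x y P' hP
    obtain ⟨Q', hQ, hc⟩ := h.1 _ _ _ _ hP
    obtain ⟨R', hR, hc'⟩ := h'.1 _ _ _ _ hQ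
    exact ⟨R', hR, hc.trans hc'⟩
  · intro x P' hP
    obtain ⟨Q', hQ, hc⟩ := h.2 _ _ hP
    obtain ⟨R', hR, hc'⟩ := h'.2 _ _ hQ
    exact ⟨R', hR, hc.trans hc'⟩

theorem sim_par_comm {V : Type} (P Q : Tm V) : Sim (par P Q) (par Q P) := by
  constructor
  · intro d x y R h
    cases h with
    | parL _ h => exact ⟨_, .parR _ h, .par_comm _ _⟩
    | parR _ h => exact ⟨_, .parL _ h, .par_comm _ _⟩
  · intro x R h
    cases h with
    | parL _ h => exact ⟨_, .parR _ h, .par_comm _ _⟩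
    | parR _ h => exact ⟨_, .parL _ h, .par_comm _ _⟩

theorem sim_par_assoc {V : Type} (P Q R : Tm V) : Sim (par (par P Q) R) (par P (par Q R)) := by
  constructor
  · intro d x y T h
    cases h with
    | parR _ h => exact ⟨_, .parR _ (.parR _ h), .par_assoc _ _ _⟩
    | parL _ h =>
      cases h with
      | parL _ h => exact ⟨_, .parL _ h, .par_assoc _ _ _⟩
      | parR _ h => exact ⟨_, .parR _ (.parL _ h), .par_assoc _ _ _⟩
  · intro x T h
    cases h with
    | parR _ h => exact ⟨_, .parR _ (.parR _ h), .par_assoc _ _ _⟩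
    | parL _ h =>
      cases h with
      | parL _ h => exact ⟨_, .parL _ h, .par_assoc _ _ _⟩
      | parR _ h => exact ⟨_, .parR _ (.parL _ h), .par_assoc _ _ _⟩

theorem sim_par_assoc_symm {V : Type} (P Q R : Tm V) :
    Sim (par P (par Q R)) (par (par P Q) R) := by
  constructor
  · intro d x y T h
    cases h with
    | parL _ h => exact ⟨_, .parL _ (.parL _ h), (TCong.par_assoc _ _ _).symm⟩
    | parR _ h =>
      cases h with
      | parL _ h => exact ⟨_, .parL _ (.parR _ h), (TCong.par_assoc _ _ _).symm⟩
      | parR _ h => exact ⟨_, .parR _ h, (TCong.par_assoc _ _ _).symm⟩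
  · intro x T h
    cases h with
    | parL _ h => exact ⟨_, .parL _ (.parL _ h), (TCong.par_assoc _ _ _).symm⟩
    | parR _ h =>
      cases h with
      | parL _ h => exact ⟨_, .parL _ (.parR _ h), (TCong.par_assoc _ _ _).symm⟩
      | parR _ h => exact ⟨_, .parR _ h, (TCong.par_assoc _ _ _).symm⟩

/-- Serves scope extrusion when the restricted process extrudes a name other than the restricted
one. Exchanging the two binders does not affect `Q`, which mentions neither. -/
theorem tcong_swap_left {V : Type} (P : Tm (Option (Option V))) (Q : Tm V) :
    TCong (par (nu (map swap P)) (map some Q))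
      (nu (map swap (par P (map some (map some Q))))) := by
  have := TCong.scope (map swap P) (map some Q)
  rw [map, map_map (map some Q) some swap, map_map Q]
  rw [map_map Q] at this
  exact this

theorem tcong_swap_right {V : Type} (P : Tm (Option V)) (Q : Tm (Option V)) :
    TCong (par (map some (nu P)) Q)
      (nu (map swap (par (map some P) (map (Option.map some) Q)))) := by
  have := TCong.scope (map (Option.map some) P) Q
  rw [map, map, map_map, map_map]
  have h₁ : swap ∘ some = (Option.map some : Option V → _) := by funext a; cases a <;> rfl
  have h₂ : swap ∘ Option.map some = (some : Option V → _) := by funext a; cases a <;> rfl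
  rw [h₁, h₂]
  exact this

theorem sim_scope {V : Type} (P : Tm (Option V)) (Q : Tm V) :
    Sim (par (nu P) Q) (nu (par P (map some Q))) := by
  constructor
  · intro d x y T h
    cases h with
    | parL _ h =>
      cases h with
      | nu h => exact ⟨_, .nu (.parL _ h), .scope _ _⟩
    | parR _ h => exact ⟨_, .nu (.parR _ (h.map some)), .scope _ _⟩
  · intro x T h
    cases h with
    | parL _ h =>
      cases h with
      | open_ h => exact ⟨_, .open_ (.parL _ h), .refl _⟩
      | nu h => exact ⟨_, .nu (.parL _ h), tcong_swap_left _ _⟩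
    | parR _ h => exact ⟨_, .nu (.parR _ (h.map some)), tcong_swap_right _ _⟩

/-- Since `Q` does not know the restricted name, it cannot send it, and its moves under the binder
are renamings of moves it makes outside (`of_map`). -/
theorem sim_scope_symm {V : Type} (P : Tm (Option V)) (Q : Tm V) :
    Sim (nu (par P (map some Q))) (par (nu P) Q) := by
  constructor
  · intro d x y T h
    cases h with
    | nu h =>
      cases h with
      | parL _ h => exact ⟨_, .parL _ (.nu h), (TCong.scope _ _).symm⟩
      | parR _ h =>
        obtain ⟨Q', h₁, rfl⟩ := h.of_map (Option.some_injective _)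
        exact ⟨_, .parR _ h₁, (TCong.scope _ _).symm⟩
  · intro x T h
    cases h with
    | open_ h =>
      cases h with
      | parL _ h => exact ⟨_, .parL _ (.open_ h), .refl _⟩
      | parR _ h => exact absurd (h.mem_fn.2 rfl) (none_notMem_fn_map_some Q)
    | nu h =>
      cases h with
      | parL _ h => exact ⟨_, .parL _ (.nu h), (tcong_swap_left _ _).symm⟩
      | parR _ h =>
        obtain ⟨Q', h₁, rfl⟩ := h.of_map (Option.some_injective _)
        exact ⟨_, .parR _ h₁, (tcong_swap_right _ _).symm⟩

theorem sim_inp {V : Type} (x : V) {P Q : Tm (Option V)} (h : TCong P Q) :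
    Sim (inp x P) (inp x Q) := by
  constructor
  · intro d x y T h'
    cases h' with
    | inp => exact ⟨_, .inp _ _ _, h.map _⟩
  · intro x T h'
    cases h'

theorem Sim.nu {V : Type} {P Q : Tm (Option V)} (h : Sim P Q) : Sim (nu P) (nu Q) := by
  constructor
  · intro d x y T h'
    cases h' with
    | nu h' =>
      obtain ⟨Q', hQ, hc⟩ := h.1 _ _ _ _ h'
      exact ⟨_, .nu hQ, .nu hc⟩
  · intro x T h'
    cases h' with
    | open_ h' =>
      obtain ⟨Q', hQ, hc⟩ := h.1 _ _ _ _ h'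
      exact ⟨_, .open_ hQ, hc⟩
    | nu h' =>
      obtain ⟨Q', hQ, hc⟩ := h.2 _ _ h'
      exact ⟨_, .nu hQ, .nu (hc.map _)⟩

theorem Sim.par {V : Type} {P P' Q Q' : Tm V} (h₁ : Sim P P') (h₂ : Sim Q Q')
    (c₁ : TCong P P') (c₂ : TCong Q Q') : Sim (par P Q) (par P' Q') := by
  constructor
  · intro d x y T h
    cases h with
    | parL _ h =>
      obtain ⟨_, h, hc⟩ := h₁.1 _ _ _ _ h
      exact ⟨_, .parL _ h, .par hc c₂⟩
    | parR _ h =>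
      obtain ⟨_, h, hc⟩ := h₂.1 _ _ _ _ h
      exact ⟨_, .parR _ h, .par c₁ hc⟩
  · intro x T h
    cases h with
    | parL _ h =>
      obtain ⟨_, h, hc⟩ := h₁.2 _ _ h
      exact ⟨_, .parL _ h, .par hc (c₂.map _)⟩
    | parR _ h =>
      obtain ⟨_, h, hc⟩ := h₂.2 _ _ h
      exact ⟨_, .parR _ h, .par (c₁.map _) hc⟩

/-- The moving copy may be unfolded arbitrarily deep inside the replication, so induction on the
derivation is needed instead of a case distinction. -/
theorem Sim.rep {V : Type} {P Q : Tm V} (h : Sim P Q) (c : TCong P Q) :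
    Sim (rep P) (rep Q) := by
  constructor
  · intro d x y T h'
    generalize hR : Tm.rep P = R at h'
    induction h' with
    | repL h' =>
      cases hR
      obtain ⟨_, h', hc⟩ := h.1 _ _ _ _ h'
      exact ⟨_, .repL h', .par hc (.rep c)⟩
    | repR h' ih =>
      cases hR
      obtain ⟨_, h', hc⟩ := ih h c rfl
      exact ⟨_, .repR h', .par c hc⟩
    | _ => cases hR
  · intro x T h'
    generalize hR : Tm.rep P = R at h'
    induction h' with
    | repL h' =>
      cases hR
      obtain ⟨_, h', hc⟩ := h.2 _ _ h'
      exact ⟨_, .repL h', .par hc (TCong.map (.rep c) _)⟩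
    | repR h' ih =>
      cases hR
      obtain ⟨_, h', hc⟩ := ih h c rfl
      exact ⟨_, .repR h', .par (c.map _) hc⟩
    | _ => cases hR

/-- Structural congruence is a bisimulation. -/
theorem TCong.sim {V : Type} {P Q : Tm V} (h : TCong P Q) : Sim P Q ∧ Sim Q P := by
  induction h with
  | refl P =>
    have : Sim P P := ⟨fun _ _ _ R h => ⟨R, h, .refl _⟩, fun _ R h => ⟨R, h, .refl _⟩⟩
    exact ⟨this, this⟩
  | symm _ ih => exact ih.symm
  | trans _ _ ih₁ ih₂ => exact ⟨ih₁.1.trans ih₂.1, ih₂.2.trans ih₁.2⟩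
  | par_comm P Q => exact ⟨sim_par_comm _ _, sim_par_comm _ _⟩
  | par_assoc P Q R => exact ⟨sim_par_assoc _ _ _, sim_par_assoc_symm _ _ _⟩
  | scope P Q => exact ⟨sim_scope _ _, sim_scope_symm _ _⟩
  | inp x h _ => exact ⟨sim_inp x h, sim_inp x h.symm⟩
  | nu _ ih => exact ⟨ih.1.nu, ih.2.nu⟩
  | par h₁ h₂ ih₁ ih₂ => exact ⟨ih₁.1.par ih₂.1 h₁ h₂, ih₁.2.par ih₂.2 h₁.symm h₂.symm⟩
  | rep h ih => exact ⟨ih.1.rep h, ih.2.rep h.symm⟩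

end Tm

end AsyncPi

/-! ### Passage between scoped terms and named processes. -/

namespace AsyncPi

open Tm (TCong FTrans BTrans inst)

theorem map_inst_eq_bind {V : Type} {g : V → Name} {w : Name} {P : Tm (Option V)}
    (hw : w ∉ g '' (some ⁻¹' P.fn)) :
    Proc.bind w (P.map (inst g w)) = P.map (Option.map g) := by
  rw [Proc.bind, Tm.map_map]
  refine Tm.map_congr _ ?_
  rintro (_ | a) ha
  · simp [inst]
  · have : g a ≠ w := fun h => hw ⟨a, ha, h⟩
    simp [inst, this]

theorem map_nu_eq_res {V : Type} {g : V → Name} {w : Name} {P : Tm (Option V)}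
    (hw : w ∉ (Tm.map g (Tm.nu P)).fn) :
    Tm.map g (Tm.nu P) = Proc.res w (P.map (inst g w)) := by
  rw [Tm.fn_map] at hw
  rw [Proc.res, map_inst_eq_bind hw, Tm.map]

theorem map_inp_eq_input {V : Type} {g : V → Name} {w : Name} {P : Tm (Option V)} {x : V}
    (hw : w ∉ (Tm.map g (Tm.nu P)).fn) :
    Tm.map g (Tm.inp x P) = Proc.input (g x) w (P.map (inst g w)) := by
  rw [Tm.fn_map] at hw
  rw [Proc.input, map_inst_eq_bind hw, Tm.map]

theorem mem_fn_bind {y a : Name} {P : Proc} : some a ∈ (Proc.bind y P).fn ↔ a ∈ P.fn ∧ a ≠ y := by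
  rw [Proc.bind, Tm.fn_map]
  constructor
  · rintro ⟨b, hb, h⟩
    by_cases hy : b = y
    · simp [hy] at h
    · simp only [hy, if_false, Option.some.injEq] at h
      subst h
      exact ⟨hb, hy⟩
  · rintro ⟨h, hy⟩
    exact ⟨a, h, by simp [hy]⟩

theorem mem_fn_res {y a : Name} {P : Proc} : a ∈ (Proc.res y P).fn ↔ a ∈ P.fn ∧ a ≠ y :=
  mem_fn_bind

theorem mem_fn_input {x y a : Name} {P : Proc} :
    a ∈ (Proc.input x y P).fn ↔ a = x ∨ a ∈ P.fn ∧ a ≠ y :=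
  or_congr Iff.rfl mem_fn_bind

theorem Cong.mem_fn_iff {P Q : Proc} (h : Cong P Q) : ∀ a, a ∈ P.fn ↔ a ∈ Q.fn := by
  induction h with
  | refl P => intro a; rfl
  | symm _ ih => intro a; exact (ih a).symm
  | trans _ _ ih₁ ih₂ => intro a; exact (ih₁ a).trans (ih₂ a)
  | par_comm P Q => intro a; exact or_comm
  | par_assoc P Q R => intro a; exact or_assoc
  | scope x P Q hx =>
    intro a
    have : a ∈ Q.fn → a ≠ x := fun h h' => hx (h' ▸ h)
    simp only [mem_fn_res, Tm.fn, Set.mem_union]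
    tauto
  | input x y _ ih => intro a; simp only [mem_fn_input, ih]
  | res y _ ih => intro a; simp only [mem_fn_res, ih]
  | par _ _ ih₁ ih₂ => intro a; exact or_congr (ih₁ a) (ih₂ a)
  | rep _ ih => intro a; exact ih a

theorem Cong.tcong {P Q : Proc} (h : Cong P Q) : TCong P Q := by
  induction h with
  | refl P => exact .refl _
  | symm _ ih => exact ih.symm
  | trans _ _ ih₁ ih₂ => exact ih₁.trans ih₂
  | par_comm P Q => exact .par_comm _ _
  | par_assoc P Q R => exact .par_assoc _ _ _
  | scope x P Q hx =>
    have : Proc.bind x Q = Q.map some := by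
      refine Tm.map_congr _ fun a ha => ?_
      have : a ≠ x := fun h => hx (h ▸ ha)
      simp [this]
    have h := TCong.scope (Proc.bind x P) Q
    rw [← this] at h
    exact h
  | input x y _ ih => exact .inp _ (ih.map _)
  | res y _ ih => exact .nu (ih.map _)
  | par _ _ ih₁ ih₂ => exact .par ih₁ ih₂
  | rep _ ih => exact .rep ih

instance : Infinite Name :=
  Infinite.of_injective Name.chan fun _ _ h => by injection h

theorem exists_fresh {s : Set Name} (hs : s.Finite) : ∃ w, w ∉ s := hs.exists_notMem

/-- A term over any name set becomes a process through an assignment `g` of actual names. Under a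
binder `g` is extended by a fresh name, so the induction has to range over all `g`. -/
theorem Tm.TCong.cong {V : Type} {P Q : Tm V} (h : TCong P Q) :
    ∀ g : V → Name, Cong (P.map g) (Q.map g) := by
  induction h with
  | refl P => intro g; exact .refl _
  | symm _ ih => intro g; exact (ih g).symm
  | trans _ _ ih₁ ih₂ => intro g; exact (ih₁ g).trans (ih₂ g)
  | par_comm P Q => intro g; exact .par_comm _ _
  | par_assoc P Q R => intro g; exact .par_assoc _ _ _
  | scope P Q =>
    intro g
    obtain ⟨w, hw⟩ := exists_fresh (Tm.fn_finite ((Tm.par (Tm.nu P) Q).map g))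
    obtain ⟨w₁, w₂⟩ := not_or.1 hw
    have h := Cong.scope w (P.map (inst g w)) (Q.map g) w₂
    rw [← map_nu_eq_res w₁] at h
    have e : Tm.map g (Tm.nu (Tm.par P (Q.map some))) =
        Proc.res w (Tm.par (P.map (inst g w)) (Q.map g)) := by
      have : Q.map g = (Q.map some).map (inst g w) := by rw [Tm.map_map]; rfl
      rw [this]
      refine map_nu_eq_res (P := Tm.par P (Q.map some)) ?_
      rw [Tm.fn_map] at hw ⊢
      rintro ⟨a, ha | ha, rfl⟩
      · exact hw ⟨a, .inl ha, rfl⟩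
      · rw [Tm.fn_map] at ha
        obtain ⟨b, hb, hab⟩ := ha
        exact hw ⟨a, .inr (Option.some.inj hab ▸ hb), rfl⟩
    rw [e]
    exact h
  | @inp V x P Q _ ih =>
    intro g
    obtain ⟨w, hw⟩ := exists_fresh (Tm.fn_finite ((Tm.par (Tm.nu P) (Tm.nu Q)).map g))
    obtain ⟨w₁, w₂⟩ := not_or.1 hw
    rw [map_inp_eq_input w₁, map_inp_eq_input w₂]
    exact .input _ _ (ih _)
  | @nu V P Q _ ih =>
    intro g
    obtain ⟨w, hw⟩ := exists_fresh (Tm.fn_finite ((Tm.par (Tm.nu P) (Tm.nu Q)).map g))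
    obtain ⟨w₁, w₂⟩ := not_or.1 hw
    rw [map_nu_eq_res w₁, map_nu_eq_res w₂]
    exact .res _ (ih _)
  | par _ _ ih₁ ih₂ => intro g; exact .par (ih₁ g) (ih₂ g)
  | rep _ ih => intro g; exact .rep (ih g)

theorem Tm.TCong.toCong {P Q : Proc} (h : TCong P Q) : Cong P Q := by
  have := h.cong _root_.id
  rwa [Tm.map_id, Tm.map_id] at this

/-- The free output or early input with the given subject and object. -/
def freeAct : Bool → Name → Name → Action
  | true, x, y => .out x y
  | false, x, y => .inp x y

theorem freeAct_names (d : Bool) (x y : Name) : (freeAct d x y).names = {x, y} := by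
  cases d <;> rfl

theorem freeAct_bn (d : Bool) (x y : Name) : (freeAct d x y).bn = ∅ := by
  cases d <;> rfl

theorem Trans.par_right {μ : Action} (P : Proc) {Q Q' : Proc} (h : Trans Q μ Q')
    (hd : Disjoint μ.bn (Tm.fn P)) : Trans (Tm.par P Q) μ (Tm.par P Q') :=
  .cong (.par_comm _ _) (.par P h hd) (.par_comm _ _)

theorem Tm.FTrans.trans_map {V : Type} {d : Bool} {x y : V} {P P' : Tm V}
    (h : FTrans d x y P P') :
    ∀ g : V → Name, Trans (P.map g) (freeAct d (g x) (g y)) (P'.map g) := by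
  induction h with
  | out x y => intro g; exact .out _ _
  | inp x z P =>
    intro g
    obtain ⟨w, hw⟩ := exists_fresh (Tm.fn_finite ((Tm.nu P).map g))
    rw [map_inp_eq_input hw]
    have e : (P.map (inst _root_.id z)).map g = Proc.subst (P.map (inst g w)) (g z) w := by
      rw [Proc.subst, Tm.map_map, Tm.map_map]
      refine Tm.map_congr _ ?_
      rintro (_ | a) ha
      · simp [inst]
      · have : g a ≠ w := fun h => hw (by rw [Tm.fn_map]; exact ⟨a, ha, h⟩)
        simp [inst, this]
    rw [e]
    exact .inp _ _ _ _
  | parL Q _ ih => intro g; exact .par _ (ih g) (by simp [freeAct_bn])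
  | parR P _ ih => intro g; exact .par_right _ (ih g) (by simp [freeAct_bn])
  | @nu V d x y P P' _ ih =>
    intro g
    obtain ⟨w, hw⟩ := exists_fresh
      ((Tm.fn_finite ((Tm.par (Tm.nu P) (Tm.nu P')).map g)).union (Set.toFinite {g x, g y}))
    obtain ⟨w₀, w₃⟩ := not_or.1 hw
    obtain ⟨w₁, w₂⟩ := not_or.1 w₀
    rw [map_nu_eq_res w₁, map_nu_eq_res w₂]
    exact .res (ih (inst g w)) (by rw [freeAct_names]; exact w₃)
  | repL _ ih => intro g; exact .rep (.par _ (ih g) (by simp [freeAct_bn]))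
  | repR _ ih => intro g; exact .rep (.par_right _ (ih g) (by simp [freeAct_bn]))

theorem Tm.FTrans.toTrans {d : Bool} {x y : Name} {P P' : Proc} (h : FTrans d x y P P') :
    Trans P (freeAct d x y) P' := by
  have := h.trans_map _root_.id
  rwa [Tm.map_id, Tm.map_id] at this

theorem Tm.BTrans.mem_fn {V : Type} {x : V} {P : Tm V} {P' : Tm (Option V)}
    (h : BTrans x P P') : x ∈ P.fn := by
  induction h with
  | open_ h => exact h.mem_fn.1
  | parL Q _ ih => exact .inl ih
  | parR P _ ih => exact .inr ih
  | nu _ ih => exact ih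
  | repL _ ih => exact ih
  | repR _ ih => exact ih

theorem map_some_inst {V : Type} (P : Tm V) (g : V → Name) (y : Name) :
    (P.map some).map (inst g y) = P.map g := by
  rw [Tm.map_map]; rfl

theorem Tm.BTrans.trans_map {V : Type} {x : V} {P : Tm V} {P' : Tm (Option V)}
    (h : BTrans x P P') : ∀ (g : V → Name) (y : Name), y ∉ (P.map g).fn →
      Trans (P.map g) (.bout (g x) y) (P'.map (inst g y)) := by
  induction h with
  | open_ h =>
    intro g y hy
    rw [map_nu_eq_res hy]
    refine .open_ (h.trans_map (inst g y)) ?_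
    rintro rfl
    rw [Tm.fn_map] at hy
    exact hy ⟨_, h.mem_fn.1, rfl⟩
  | parL Q _ ih =>
    intro g y hy
    rw [Tm.map, Tm.map, map_some_inst]
    exact .par _ (ih g y fun h => hy (.inl h))
      (Set.disjoint_singleton_left.2 fun h => hy (.inr h))
  | parR P _ ih =>
    intro g y hy
    rw [Tm.map, Tm.map, map_some_inst]
    exact .par_right _ (ih g y fun h => hy (.inr h))
      (Set.disjoint_singleton_left.2 fun h => hy (.inl h))
  | @nu V x P P' h ih =>
    intro g y hy
    obtain ⟨w, hw⟩ := exists_fresh ((Tm.fn_finite ((Tm.nu P).map g)).union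
      ((Tm.fn_finite ((Tm.nu (P'.map Tm.swap)).map (inst g y))).union (Set.toFinite {g x, y})))
    obtain ⟨w₁, hw⟩ := not_or.1 hw
    obtain ⟨w₂, w₃⟩ := not_or.1 hw
    rw [map_nu_eq_res w₁, map_nu_eq_res w₂]
    have key := ih (inst g w) y (by
      rw [Tm.fn_map] at hy ⊢
      rintro ⟨_ | a, ha, h⟩
      · exact w₃ (.inr (by exact h))
      · exact hy ⟨a, ha, h⟩)
    -- `swap` accounts for the opposite order in which the extruded name `y` and the restricted name
    -- `w` are instantiated.
    have e : (P'.map Tm.swap).map (inst (inst g y) w) = P'.map (inst (inst g w) y) := by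
      rw [Tm.map_map]
      congr 1
      funext a
      rcases a with _ | _ | a <;> rfl
    rw [e]
    exact .res key w₃
  | @repL V x P P' _ ih =>
    intro g y hy
    have e : (Tm.par P' (P.rep.map some)).map (inst g y) =
      Tm.par (P'.map (inst g y)) (P.rep.map g) := by rw [Tm.map, map_some_inst]
    rw [e]
    exact .rep (.par _ (ih g y hy) (Set.disjoint_singleton_left.2 hy))
  | repR _ ih =>
    intro g y hy
    rw [Tm.map, Tm.map, map_some_inst]
    exact .rep (.par_right _ (ih g y hy) (Set.disjoint_singleton_left.2 hy))

theorem Tm.BTrans.toTrans {x y : Name} {P : Proc} {P' : Tm (Option Name)} (h : BTrans x P P')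
    (hy : y ∉ P.fn) : Trans P (.bout x y) (P'.map (inst _root_.id y)) := by
  have := h.trans_map _root_.id y (by rwa [Tm.map_id])
  rwa [Tm.map_id] at this

/-- The transition of `P` with the given label and target, as a transition derived without
structural congruence. -/
def Raw (P : Proc) : Action → Proc → Prop
  | .out x y, Q => ∃ Q₀, FTrans true x y P Q₀ ∧ TCong Q₀ Q
  | .inp x y, Q => ∃ Q₀, FTrans false x y P Q₀ ∧ TCong Q₀ Q
  | .bout x y, Q => ∃ Q₀, BTrans x P Q₀ ∧ TCong (Q₀.map (inst _root_.id y)) Q ∧ y ∉ P.fn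
  | .tau, _ => True

theorem bind_map_inst {y z : Name} (h : y ≠ z) (Q : Tm (Option Name)) :
    Tm.map (inst _root_.id z) (Tm.nu (Tm.map Tm.swap
      (Q.map (Option.map fun a : Name => if a = y then none else some a)))) =
    Proc.res y (Q.map (inst _root_.id z)) := by
  rw [Tm.map, Proc.res, Proc.bind, Tm.map_map, Tm.map_map, Tm.map_map]
  congr 2
  funext a
  rcases a with _ | a
  · simp [inst, Tm.swap, h.symm]
  · by_cases ha : a = y <;> simp [inst, Tm.swap, ha]

theorem Raw.cong {P P' : Proc} {μ : Action} {Q' Q : Proc} (h : Cong P P') (hr : Raw P' μ Q')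
    (h' : Cong Q' Q) : Raw P μ Q := by
  have hs := h.tcong.sim.2
  cases μ with
  | out x y =>
    obtain ⟨Q₀, h₁, h₂⟩ := hr
    obtain ⟨R, h₃, h₄⟩ := hs.1 _ _ _ _ h₁
    exact ⟨R, h₃, h₄.symm.trans (h₂.trans h'.tcong)⟩
  | inp x y =>
    obtain ⟨Q₀, h₁, h₂⟩ := hr
    obtain ⟨R, h₃, h₄⟩ := hs.1 _ _ _ _ h₁
    exact ⟨R, h₃, h₄.symm.trans (h₂.trans h'.tcong)⟩
  | bout x y =>
    obtain ⟨Q₀, h₁, h₂, h₅⟩ := hr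
    obtain ⟨R, h₃, h₄⟩ := hs.2 _ _ h₁
    exact ⟨R, h₃, (h₄.symm.map _).trans (h₂.trans h'.tcong), fun h₆ => h₅ ((h.mem_fn_iff _).1 h₆)⟩
  | tau => trivial

/-- Uses of structural congruence anywhere in a derivation are pushed to the target by `TCong.sim`.
Silent moves need no such form, because only visible ones have to commute. -/
theorem Trans.raw {P : Proc} {μ : Action} {Q : Proc} (h : Trans P μ Q) : Raw P μ Q := by
  induction h with
  | inp x y z P =>
    refine ⟨_, .inp _ _ _, ?_⟩
    rw [Proc.bind, Tm.map_map, Proc.subst]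
    convert TCong.refl _ using 2
    funext a
    by_cases ha : a = y <;> simp [inst, ha]
  | out x y => exact ⟨_, .out _ _, .refl _⟩
  | @open_ x y P P' _ hxy ih =>
    obtain ⟨Q₀, h₁, h₂⟩ := ih
    have := h₁.map (fun a : Name => if a = y then none else some a)
    simp only [hxy, if_false, if_true] at this
    refine ⟨_, .open_ this, ?_, fun h => (mem_fn_res.1 h).2 rfl⟩
    rw [Tm.map_map]
    refine TCong.trans ?_ h₂
    convert TCong.refl _ using 1
    refine (Tm.map_of_fixed fun a _ => ?_).symm
    by_cases ha : a = y <;> simp [inst, ha]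
  | @res y μ P P' _ hy ih =>
    cases μ with
    | tau => trivial
    | out x z =>
      obtain ⟨Q₀, h₁, h₂⟩ := ih
      have := h₁.map (fun a : Name => if a = y then none else some a)
      obtain ⟨hx, hz⟩ := not_or.1 hy
      simp only [Ne.symm hx, show z ≠ y from fun h => hz h.symm, if_false] at this
      exact ⟨_, .nu this, .nu (h₂.map _)⟩
    | inp x z =>
      obtain ⟨Q₀, h₁, h₂⟩ := ih
      have := h₁.map (fun a : Name => if a = y then none else some a)
      obtain ⟨hx, hz⟩ := not_or.1 hy
      simp only [Ne.symm hx, show z ≠ y from fun h => hz h.symm, if_false] at this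
      exact ⟨_, .nu this, .nu (h₂.map _)⟩
    | bout x z =>
      obtain ⟨Q₀, h₁, h₂, h₃⟩ := ih
      have := h₁.map (fun a : Name => if a = y then none else some a)
      obtain ⟨hx, hz⟩ := not_or.1 hy
      simp only [Ne.symm hx, if_false] at this
      refine ⟨_, .nu this, ?_, fun h => h₃ (mem_fn_res.1 h).1⟩
      rw [bind_map_inst hz]
      exact .nu (h₂.map _)
  | @par μ P P' Q _ hd ih =>
    cases μ with
    | tau => trivial
    | out x z =>
      obtain ⟨Q₀, h₁, h₂⟩ := ih
      exact ⟨_, .parL _ h₁, .par h₂ (.refl _)⟩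
    | inp x z =>
      obtain ⟨Q₀, h₁, h₂⟩ := ih
      exact ⟨_, .parL _ h₁, .par h₂ (.refl _)⟩
    | bout x z =>
      obtain ⟨Q₀, h₁, h₂, h₃⟩ := ih
      refine ⟨_, .parL _ h₁, ?_, ?_⟩
      · rw [Tm.map, map_some_inst, Tm.map_id]
        exact .par h₂ (.refl _)
      · rintro (h | h)
        · exact h₃ h
        · exact Set.disjoint_singleton_left.1 hd h
  | com => trivial
  | close => trivial
  | @rep μ P P' _ ih =>
    cases μ with
    | tau => trivial
    | out x z =>
      obtain ⟨Q₀, h₁, h₂⟩ := ih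
      cases h₁ with
      | parL _ h₁ => exact ⟨_, .repL h₁, h₂⟩
      | parR _ h₁ => exact ⟨_, .repR h₁, h₂⟩
    | inp x z =>
      obtain ⟨Q₀, h₁, h₂⟩ := ih
      cases h₁ with
      | parL _ h₁ => exact ⟨_, .repL h₁, h₂⟩
      | parR _ h₁ => exact ⟨_, .repR h₁, h₂⟩
    | bout x z =>
      obtain ⟨Q₀, h₁, h₂, h₃⟩ := ih
      have h₃ : z ∉ P.rep.fn := fun h => h₃ (.inl h)
      cases h₁ with
      | parL _ h₁ => exact ⟨_, .repL h₁, h₂, h₃⟩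
      | parR _ h₁ => exact ⟨_, .repR h₁, h₂, h₃⟩
  | cong h _ h' ih => exact ih.cong h h'

namespace Trans

theorem source_cong {P Q R : Proc} {μ : Action} (h : Trans P μ Q) (c : TCong P R) :
    Trans R μ Q :=
  .cong c.symm.toCong h (.refl _)

theorem inp_subject_mem {P Q : Proc} {x y : Name} (h : Trans P (.inp x y) Q) : x ∈ P.fn := by
  obtain ⟨_, h, _⟩ := h.raw
  exact h.mem_fn.1

theorem bout_subject_mem {P Q : Proc} {x y : Name} (h : Trans P (.bout x y) Q) : x ∈ P.fn := by
  obtain ⟨_, h, _⟩ := h.raw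
  exact h.mem_fn

theorem bout_notMem {P Q : Proc} {x y : Name} (h : Trans P (.bout x y) Q) : y ∉ P.fn := by
  obtain ⟨_, _, _, h⟩ := h.raw
  exact h

/-- The free names of the target of a visible transition. -/
theorem fn_target {P Q : Proc} {μ : Action} (h : Trans P μ Q) (hμ : μ ≠ .tau) :
    ∀ a ∈ Q.fn, a ∈ P.fn ∨ a ∈ μ.names := by
  induction h with
  | inp x y z P =>
    intro a ha
    rw [Proc.subst, Tm.fn_map] at ha
    obtain ⟨b, hb, rfl⟩ := ha
    by_cases hy : b = y
    · simp [hy, Action.names]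
    · simp [hy, mem_fn_input, hb]
  | out x y => intro a ha; cases ha
  | @open_ x y P P' _ _ ih =>
    intro a ha
    rw [mem_fn_res]
    by_cases hy : a = y
    · exact .inr (.inr hy)
    · exact (ih (by simp) a ha).imp (fun h => ⟨h, hy⟩) fun h => h
  | res _ _ ih =>
    intro a ha
    rw [mem_fn_res] at ha ⊢
    exact (ih hμ a ha.1).imp (fun h => ⟨h, ha.2⟩) fun h => h
  | par Q _ _ ih =>
    rintro a (ha | ha)
    · exact (ih hμ a ha).imp .inl fun h => h
    · exact .inl (.inr ha)
  | com => exact absurd rfl hμ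
  | close => exact absurd rfl hμ
  | rep _ ih =>
    intro a ha
    exact (ih hμ a ha).imp (fun h => h.elim (fun h => h) fun h => h) fun h => h
  | cong h _ h' ih =>
    intro a ha
    exact (ih hμ a ((h'.mem_fn_iff a).2 ha)).imp (h.mem_fn_iff a).2 fun h => h

/-- A free output commutes with an input. -/
theorem out_inp_diamond {P Q R : Proc} {x y x' z : Name} (h : Trans P (.out x y) Q)
    (h' : Trans P (.inp x' z) R) :
    ∃ T, Trans Q (.inp x' z) T ∧ Trans R (.out x y) T := by
  obtain ⟨Q₀, h₁, c₁⟩ := h.raw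
  obtain ⟨R₀, h₂, c₂⟩ := h'.raw
  obtain ⟨T, h₃, h₄⟩ := h₁.diamond rfl h₂
  exact ⟨T, source_cong h₃.toTrans c₁, source_cong h₄.toTrans c₂⟩

/-- A bound output commutes with an input. -/
theorem bout_inp_diamond {P Q R : Proc} {x y x' z : Name} (h : Trans P (.bout x y) Q)
    (h' : Trans P (.inp x' z) R) (hz : z ≠ y) :
    ∃ T, Trans Q (.inp x' z) T ∧ Trans R (.bout x y) T := by
  obtain ⟨Q₀, h₁, c₁, hy⟩ := h.raw
  obtain ⟨R₀, h₂, c₂⟩ := h'.raw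
  obtain ⟨T, h₃, h₄⟩ := h₁.diamond h₂
  -- The input could bring in `y` only as the received name, and `z ≠ y`.
  have hyR : y ∉ R₀.fn := fun hR =>
    (fn_target h₂.toTrans (by simp [freeAct]) y hR).elim hy (by
      rintro (h | h)
      · exact hy (h ▸ h₂.mem_fn.1)
      · exact hz h.symm)
  exact ⟨_, source_cong (h₃.map (inst _root_.id y)).toTrans c₁,
    source_cong (h₄.toTrans hyR) c₂⟩

end Trans

/-! ### Invariance of transitions under injective renaming. -/

/-- Renaming of an action. -/
def Action.map (f : Name → Name) : Action → Action
  | inp x y => inp (f x) (f y)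
  | out x y => out (f x) (f y)
  | bout x y => bout (f x) (f y)
  | tau => tau

theorem Action.map_map (f g : Name → Name) (μ : Action) : (μ.map f).map g = μ.map (g ∘ f) := by
  cases μ <;> rfl

theorem Action.map_id (μ : Action) : μ.map id = μ := by
  cases μ <;> rfl

theorem Action.map_ne_tau (f : Name → Name) {μ : Action} (h : μ ≠ tau) : μ.map f ≠ tau := by
  cases μ <;> simp_all [Action.map]

theorem Action.names_map (f : Name → Name) (μ : Action) : (μ.map f).names = f '' μ.names := by
  cases μ <;> simp [Action.map, Action.names, Set.image_insert_eq]

theorem Action.bn_map (f : Name → Name) (μ : Action) : (μ.map f).bn = f '' μ.bn := by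
  cases μ <;> simp [Action.map, Action.bn]

theorem map_bind {f : Name → Name} (hf : f.Injective) (y : Name) (P : Proc) :
    Tm.map (Option.map f) (Proc.bind y P) = Proc.bind (f y) (P.map f) := by
  rw [Proc.bind, Proc.bind, Tm.map_map, Tm.map_map]
  congr 1
  funext a
  by_cases ha : a = y <;> simp [ha, hf.eq_iff]

theorem map_res {f : Name → Name} (hf : f.Injective) (y : Name) (P : Proc) :
    Tm.map f (Proc.res y P) = Proc.res (f y) (P.map f) := by
  rw [Proc.res, Proc.res, Tm.map, map_bind hf]

theorem map_input {f : Name → Name} (hf : f.Injective) (x y : Name) (P : Proc) :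
    Tm.map f (Proc.input x y P) = Proc.input (f x) (f y) (P.map f) := by
  rw [Proc.input, Proc.input, Tm.map, map_bind hf]

theorem Trans.map {f : Name → Name} (hf : f.Injective) {P : Proc} {μ : Action} {Q : Proc}
    (h : Trans P μ Q) : Trans (P.map f) (μ.map f) (Q.map f) := by
  induction h with
  | inp x y z P =>
    have e : Tm.map f (Proc.subst P z y) = Proc.subst (P.map f) (f z) (f y) := by
      rw [Proc.subst, Proc.subst, Tm.map_map, Tm.map_map]
      congr 1
      funext a
      by_cases ha : a = y <;> simp [ha, hf.eq_iff]
    rw [map_input hf, e]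
    exact .inp _ _ _ _
  | out x y => exact .out _ _
  | open_ _ hxy ih => rw [map_res hf]; exact .open_ ih (hf.ne hxy)
  | res _ hy ih =>
    rw [map_res hf, map_res hf]
    refine .res ih ?_
    rw [Action.names_map]
    rintro ⟨b, hb, h⟩
    exact hy (hf h ▸ hb)
  | par Q _ hd ih =>
    refine .par _ ih ?_
    rw [Action.bn_map, Tm.fn_map]
    exact (Set.disjoint_image_iff hf).2 hd
  | com _ _ ih₁ ih₂ => exact .com ih₁ ih₂
  | close _ _ hy ih₁ ih₂ =>
    rw [map_res hf]
    refine .close ih₁ ih₂ ?_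
    rw [Tm.fn_map]
    rintro ⟨b, hb, h⟩
    exact hy (hf h ▸ hb)
  | rep _ ih => exact .rep ih
  | cong h _ h' ih => exact .cong (h.tcong.cong f) ih (h'.tcong.cong f)

end AsyncPi

/-! ### Free rotations of nodes and names. -/

namespace AsyncPi

open Equiv (Perm)

theorem pow_apply_of_semiconj {α β : Type*} {ι : α → β} {e : Perm α} {f : Perm β}
    (h : ∀ x, f (ι x) = ι (e x)) (m : ℕ) (x : α) : (f ^ m) (ι x) = ι ((e ^ m) x) := by
  induction m generalizing x with
  | zero => rfl
  | succ m ih => rw [pow_succ, pow_succ, Perm.mul_apply, Perm.mul_apply, h, ih]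

theorem ncard_range_pow_apply {α : Type*} [Finite α] (s : Perm α) (x : α) :
    {y | ∃ i : ℕ, y = (s ^ i) x}.ncard = Function.minimalPeriod s x := by
  have hp : 0 < Function.minimalPeriod s x :=
    Function.minimalPeriod_pos_of_mem_periodicPts
      (Function.Injective.mem_periodicPts s.injective x)
  have : {y | ∃ i : ℕ, y = (s ^ i) x} =
      (fun i => s^[i] x) '' Set.Iio (Function.minimalPeriod s x) := by
    ext y
    constructor
    · rintro ⟨i, rfl⟩
      refine ⟨i % Function.minimalPeriod s x, Nat.mod_lt _ hp, ?_⟩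
      simp only [Function.iterate_mod_minimalPeriod_eq, Perm.iterate_eq_pow]
    · rintro ⟨i, _, rfl⟩
      exact ⟨i, by simp only [Perm.iterate_eq_pow]⟩
  rw [this, Function.iterate_injOn_Iio_minimalPeriod.ncard_image,
    Set.ncard_eq_toFinset_card']
  simp

/-- A point fixed by `s ^ m` makes `m` a multiple of its orbit length, which is the length of every
orbit. -/
theorem pow_eq_one_of_apply_eq {α : Type*} [Finite α] {s : Perm α}
    (h : ∀ x y, {z | ∃ i : ℕ, z = (s ^ i) x}.ncard = {z | ∃ i : ℕ, z = (s ^ i) y}.ncard)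
    {m : ℕ} {x : α} (hx : (s ^ m) x = x) : s ^ m = 1 := by
  ext y
  have h₁ : Function.IsPeriodicPt s m x := by
    rw [Function.IsPeriodicPt, Function.IsFixedPt, Perm.iterate_eq_pow, hx]
  have h₂ : Function.minimalPeriod s y ∣ m := by
    rw [← ncard_range_pow_apply, h y x, ncard_range_pow_apply]
    exact h₁.minimalPeriod_dvd
  have h₃ : Function.IsPeriodicPt s m y :=
    (Function.isPeriodicPt_minimalPeriod s y).trans_dvd h₂
  rw [Function.IsPeriodicPt, Function.IsFixedPt, Perm.iterate_eq_pow] at h₃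
  simpa using h₃

/-- Compatible permutations of the nodes and of the names, acting freely on the nodes, with an
infinite supply of further names on which they also act freely. -/
structure Rotation (k : ℕ) where
  node : Perm (Fin k)
  name : Perm Name
  node_ne : ∀ i, node i ≠ i
  free : ∀ (m : ℕ) (i : Fin k), (node ^ m) i = i → node ^ m = 1 ∧ name ^ m = 1
  name_o : name .o = .o
  name_node : ∀ i, name (nodeName i) = nodeName (node i)
  supply : ℕ × Fin k → Name
  supply_injective : supply.Injective
  name_supply : ∀ q i, name (supply (q, i)) = supply (q, node i)

theorem nodeName_injective {k : ℕ} : Function.Injective (nodeName (k := k)) := by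
  intro i j h
  simp only [nodeName, Name.num.injEq, Nat.add_right_cancel_iff] at h
  exact Fin.ext h

theorem Network.mem_arcs {k : ℕ} {P : Network k} {i : Fin k} {a : Name} (h : a ∈ (P i).fn)
    (ho : a ≠ .o) : a ∈ P.arcs :=
  ⟨Set.mem_iUnion.2 ⟨i, h⟩, ho⟩

theorem Network.rename_of_notMem {k : ℕ} {P : Network k} (σ : P.hypergraph.Aut) {a : Name}
    (h : a ∉ P.arcs) : P.rename σ a = a := dif_neg h

theorem Network.rename_of_mem {k : ℕ} {P : Network k} (σ : P.hypergraph.Aut) {a : Name}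
    (h : a ∈ P.arcs) : P.rename σ a = Subtype.val (p := (· ∈ P.arcs)) (σ.onX ⟨a, h⟩) := dif_pos h

theorem Network.rename_mem {k : ℕ} {P : Network k} (σ : P.hypergraph.Aut) {a : Name}
    (h : a ∈ P.arcs) : P.rename σ a ∈ P.arcs := by
  rw [Network.rename_of_mem σ h]
  exact (σ.onX ⟨a, h⟩).2

/-- A symmetric network has no symmetry that fixes every node and moves an arc. -/
theorem Network.onN_ne_one {k : ℕ} {P : Network k} {σ : P.hypergraph.Aut}
    (hne : σ ≠ Hypergraph.Aut.id P.hypergraph) (hsym : P.SymmetricWrt σ) : σ.onN ≠ 1 := by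
  intro h
  refine hne (Hypergraph.Aut.ext h (Equiv.ext fun a => Subtype.ext ?_))
  obtain ⟨a, ha⟩ := a
  obtain ⟨i, hi⟩ := Set.mem_iUnion.1 ha.1
  have := hsym i
  rw [h] at this
  exact (Network.rename_of_mem σ ha).symm.trans (Tm.fixed_of_map (P i) this.symm a hi)

theorem exists_chan_bound {s : Set Name} (hs : s.Finite) : ∃ N, ∀ n, Name.chan (N + n) ∉ s := by
  have hinj : Function.Injective Name.chan := fun _ _ h => by injection h
  obtain ⟨N, hN⟩ := (hs.preimage (f := Name.chan) hinj.injOn).bddAbove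
  refine ⟨N + 1, fun n hn => ?_⟩
  have := hN (show N + 1 + n ∈ Name.chan ⁻¹' s from hn)
  omega

/-- The permutation of the arcs is extended to all names: it follows `σ` on node identifiers that
are not arcs and on infinitely many copies of the node set made of unused channels, and fixes the
rest, including `o`. The copies supply private names that can be chosen compatibly with the
rotation. -/
theorem Network.exists_rotation {k : ℕ} {P : Network k} {σ : P.hypergraph.Aut}
    (hbal : σ.WellBalanced) (hne : σ ≠ Hypergraph.Aut.id P.hypergraph)
    (hid : P.RespectsIdentifiers σ) (hsym : P.SymmetricWrt σ) :
    ∃ ρ : Rotation k, ∀ i, P (ρ.node i) = (P i).map ρ.name := by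
  classical
  let s : Perm (Fin k) := σ.onN
  let t : Perm P.arcs := σ.onX
  have hs1 : s ≠ 1 := Network.onN_ne_one hne hsym
  have hfree : ∀ {m : ℕ} {i : Fin k}, (s ^ m) i = i → s ^ m = 1 := fun {m i} =>
    pow_eq_one_of_apply_eq (α := Fin k) hbal
  have hmaps : ∀ i, nodeName i ∈ P.arcs → nodeName (s i) ∈ P.arcs := fun i hi => by
    have := Network.rename_mem σ hi
    rwa [hid i hi] at this
  have hmaps' : ∀ m i, nodeName i ∈ P.arcs → nodeName ((s ^ m) i) ∈ P.arcs := by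
    intro m
    induction m with
    | zero => exact fun i hi => hi
    | succ m ih => intro i hi; rw [pow_succ']; exact hmaps _ (ih i hi)
  -- Forward invariance suffices, because the inverse of `s` is one of its powers.
  have hiff : ∀ i, nodeName (s i) ∉ P.arcs ↔ nodeName i ∉ P.arcs := by
    intro i
    refine not_congr ⟨fun h => ?_, hmaps i⟩
    have := hmaps' (orderOf s - 1) _ h
    rwa [← Perm.mul_apply, ← pow_succ, Nat.sub_add_cancel (orderOf_pos s),
      pow_orderOf_eq_one] at this
  obtain ⟨N, hN⟩ := exists_chan_bound P.arcs_finite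
  let u : ℕ × Fin k → Name := fun p => .chan (N + Nat.pair p.1 p.2)
  have hu : u.Injective := by
    rintro ⟨q, i⟩ ⟨q', i'⟩ h
    simp only [u, Name.chan.injEq, Nat.add_left_cancel_iff, Nat.pair_eq_pair] at h
    exact Prod.ext h.1 (Fin.ext h.2)
  let ι : P.arcs ⊕ {i : Fin k // nodeName i ∉ P.arcs} ⊕ (ℕ × Fin k) → Name :=
    Sum.elim Subtype.val (Sum.elim (fun i => nodeName i.1) u)
  have hι : ι.Injective := by
    refine Subtype.val_injective.sumElim (Function.Injective.sumElim
      (nodeName_injective.comp Subtype.val_injective) hu ?_) ?_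
    · intro a b h; simp [nodeName, u] at h
    · rintro a (b | b) h
      · exact b.2 (by rw [← show a.1 = nodeName b.1 from h]; exact a.2)
      · exact hN _ (show u b ∈ P.arcs by rw [← show a.1 = u b from h]; exact a.2)
  let e : Perm (P.arcs ⊕ {i : Fin k // nodeName i ∉ P.arcs} ⊕ (ℕ × Fin k)) :=
    Equiv.sumCongr t (Equiv.sumCongr (s.subtypePerm hiff) (Equiv.prodCongr (Equiv.refl ℕ) s))
  let f : Perm Name := e.viaEmbedding ⟨ι, hι⟩
  have hf : ∀ x, f (ι x) = ι (e x) := fun x => Perm.viaEmbedding_apply e ⟨ι, hι⟩ x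
  have hf' : ∀ a, a ∉ Set.range ι → f a = a := fun a ha =>
    Perm.viaEmbedding_apply_of_notMem e ⟨ι, hι⟩ a ha
  have hfarc : ∀ a ∈ P.arcs, f a = P.rename σ a := fun a ha => by
    rw [Network.rename_of_mem σ ha]
    exact hf (.inl ⟨a, ha⟩)
  have hfo : f .o = .o := by
    refine hf' _ ?_
    rintro ⟨a | a | a, h⟩
    · exact a.2.2 h
    · cases h
    · cases h
  have hfnode : ∀ i, f (nodeName i) = nodeName (s i) := fun i => by
    by_cases hi : nodeName i ∈ P.arcs
    · rw [hfarc _ hi]; exact hid i hi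
    · exact hf (.inr (.inl ⟨i, hi⟩))
  have hfu : ∀ q i, f (u (q, i)) = u (q, s i) := fun q i => hf (.inr (.inr (q, i)))
  have hP : ∀ i, P (s i) = (P i).map f := fun i => by
    refine (hsym i).trans (Tm.map_congr _ fun a ha => ?_)
    by_cases ho : a = .o
    · subst ho
      rw [hfo, Network.rename_of_notMem]
      exact fun h => h.2 rfl
    · exact (hfarc a (Network.mem_arcs ha ho)).symm
  have hPm : ∀ m i, P ((s ^ m) i) = (P i).map (f ^ m : Perm Name) := by
    intro m
    induction m with
    | zero => intro i; exact (Tm.map_id _).symm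
    | succ m ih => intro i; rw [pow_succ', Perm.mul_apply, hP, ih, Tm.map_map, pow_succ']; rfl
  -- On arcs this rests on symmetry: `f ^ m` leaves each `P i` unchanged, so it fixes the free
  -- names. Elsewhere `f` copies `s` or is the identity.
  have hfm : ∀ m, s ^ m = 1 → f ^ m = 1 := by
    intro m hm
    ext a
    by_cases ha : a ∈ Set.range ι
    · obtain ⟨a | a | ⟨q, i⟩, rfl⟩ := ha
      · obtain ⟨a, ha⟩ := a
        obtain ⟨i, hi⟩ := Set.mem_iUnion.1 ha.1
        have := hPm m i
        rw [hm] at this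
        exact Tm.fixed_of_map (P i) this.symm a hi
      · have := pow_apply_of_semiconj hfnode m a.1
        rw [hm] at this
        exact this
      · have := pow_apply_of_semiconj (ι := fun i => u (q, i)) (hfu q) m i
        rw [hm] at this
        exact this
    · exact Perm.pow_apply_eq_self_of_apply_eq_self (hf' a ha) m
  exact ⟨⟨s, f, fun i hi => hs1 (by simpa using hfree (m := 1) (i := i) (by simpa using hi)),
    fun m i h => ⟨hfree h, hfm m (hfree h)⟩, hfo, hfnode, u, hu, hfu⟩, hP⟩

end AsyncPi

/-! ### Invariant families of processes and the stages of a round. -/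

namespace AsyncPi

open Equiv (Perm)
open Relation (ReflTransGen TransGen)

theorem exists_pow_lt_iff {α : Type*} {g : Perm α} {d : ℕ} (hd : 0 < d) (hg : g ^ d = 1)
    (x y : α) : (∃ r < d, (g ^ r) x = y) ↔ ∃ r : ℕ, (g ^ r) x = y := by
  constructor
  · rintro ⟨r, _, h⟩
    exact ⟨r, h⟩
  · rintro ⟨r, h⟩
    exact ⟨r % d, Nat.mod_lt _ hd, by rwa [← pow_eq_pow_mod r hg]⟩

theorem exists_pow_apply_iff {α : Type*} {g : Perm α} {d : ℕ} (hd : 0 < d) (hg : g ^ d = 1)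
    (x y : α) : (∃ r : ℕ, (g ^ r) x = g y) ↔ ∃ r : ℕ, (g ^ r) x = y := by
  constructor
  · rintro ⟨r, h⟩
    refine ⟨d - 1 + r, ?_⟩
    rw [pow_add, Perm.mul_apply, h, ← Perm.mul_apply, ← pow_succ, Nat.sub_add_cancel hd, hg]
    rfl
  · rintro ⟨r, h⟩
    exact ⟨r + 1, by rw [pow_succ', Perm.mul_apply, h]⟩

theorem exists_pow_lt_apply_iff {α : Type*} {g : Perm α} {d : ℕ} (hd : 0 < d) (hg : g ^ d = 1)
    (x y : α) : (∃ r < d, (g ^ r) x = g y) ↔ ∃ r < d, (g ^ r) x = y := by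
  rw [exists_pow_lt_iff hd hg, exists_pow_lt_iff hd hg, exists_pow_apply_iff hd hg]

variable {k : ℕ} (ρ : Rotation k)

namespace Rotation

/-- The order of the permutation of the nodes. -/
noncomputable def period : ℕ := orderOf ρ.node

theorem period_pos : 0 < ρ.period := orderOf_pos _

theorem node_pow_period : ρ.node ^ ρ.period = 1 := pow_orderOf_eq_one _

/-- A node is required: `free` controls `name` only through a fixed node. -/
theorem name_pow_period (i : Fin k) : ρ.name ^ ρ.period = 1 :=
  (ρ.free ρ.period i (by rw [node_pow_period]; rfl)).2

/-- Exponents leading to the same node differ by a power that fixes a node, hence is trivial on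
names. This makes `spread` independent of the exponent chosen. -/
theorem name_pow_eq {a b : ℕ} {i : Fin k} (h : (ρ.node ^ a) i = (ρ.node ^ b) i) :
    ρ.name ^ a = ρ.name ^ b := by
  wlog hab : a ≤ b generalizing a b
  · exact (this h.symm (by omega)).symm
  · obtain ⟨c, rfl⟩ := Nat.exists_eq_add_of_le hab
    rw [pow_add, Perm.mul_apply] at h
    rw [pow_add, (ρ.free c i ((ρ.node ^ a).injective h).symm).2, mul_one]

/-- By freeness every orbit is as long as the order of `node`, so the turns of a round visit
distinct nodes. -/
theorem node_pow_ne {r s : ℕ} (hs : s < r) (hr : r < ρ.period) (i : Fin k) :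
    (ρ.node ^ s) i ≠ (ρ.node ^ r) i := by
  intro h
  obtain ⟨c, rfl⟩ := Nat.exists_eq_add_of_le hs.le
  rw [pow_add, Perm.mul_apply] at h
  exact pow_ne_one_of_lt_orderOf (by omega) (by unfold period at hr; omega)
    (ρ.free c i ((ρ.node ^ s).injective h).symm).1

theorem name_pow_supply (r q : ℕ) (i : Fin k) :
    (ρ.name ^ r) (ρ.supply (q, i)) = ρ.supply (q, (ρ.node ^ r) i) :=
  pow_apply_of_semiconj (ι := fun i => ρ.supply (q, i)) (ρ.name_supply q) r i

theorem exists_supply {s : Set Name} (hs : s.Finite) : ∃ q, ∀ i, ρ.supply (q, i) ∉ s := by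
  obtain ⟨q, hq⟩ :=
    ((hs.preimage ρ.supply_injective.injOn).image Prod.fst).exists_notMem
  exact ⟨q, fun i hi => hq ⟨(q, i), hi, rfl⟩⟩

/-- The family of processes is invariant under the rotation. -/
def Equivariant (C : Network k) : Prop := ∀ i, C (ρ.node i) = (C i).map ρ.name

variable {ρ}

theorem Equivariant.pow {C : Network k} (h : ρ.Equivariant C) (r : ℕ) (i : Fin k) :
    C ((ρ.node ^ r) i) = (C i).map (ρ.name ^ r : Perm Name) := by
  induction r with
  | zero => exact (Tm.map_id _).symm
  | succ r ih => rw [pow_succ', Perm.mul_apply, h, ih, Tm.map_map, pow_succ']; rfl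

variable (ρ)

open Classical in
/-- The family whose value on the orbit of `j` is given by rotating `Q`, starting at `j`. -/
noncomputable def spread (C : Network k) (j : Fin k) (Q : Proc) : Network k := fun l =>
  if h : ∃ r : ℕ, (ρ.node ^ r) j = l then Q.map (ρ.name ^ h.choose : Perm Name) else C l

theorem spread_pow (C : Network k) (j : Fin k) (Q : Proc) (r : ℕ) :
    ρ.spread C j Q ((ρ.node ^ r) j) = Q.map (ρ.name ^ r : Perm Name) := by
  have h : ∃ s : ℕ, (ρ.node ^ s) j = (ρ.node ^ r) j := ⟨r, rfl⟩
  rw [spread, dif_pos h, ρ.name_pow_eq h.choose_spec]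

theorem spread_self (C : Network k) (j : Fin k) (Q : Proc) : ρ.spread C j Q j = Q :=
  (ρ.spread_pow C j Q 0).trans (Tm.map_id _)

theorem spread_of_not {C : Network k} {j l : Fin k} (Q : Proc)
    (h : ¬ ∃ r : ℕ, (ρ.node ^ r) j = l) : ρ.spread C j Q l = C l := dif_neg h

theorem equivariant_spread {C : Network k} (hC : ρ.Equivariant C) (j : Fin k) (Q : Proc) :
    ρ.Equivariant (ρ.spread C j Q) := by
  intro l
  by_cases h : ∃ r : ℕ, (ρ.node ^ r) j = l
  · obtain ⟨r, rfl⟩ := h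
    rw [← Perm.mul_apply, ← pow_succ', spread_pow, spread_pow, Tm.map_map, pow_succ']
    rfl
  · rw [ρ.spread_of_not Q h, ρ.spread_of_not Q, hC]
    rwa [exists_pow_apply_iff ρ.period_pos ρ.node_pow_period]

theorem exists_pow_symm {i j : Fin k} (h : ∃ r : ℕ, (ρ.node ^ r) i = j) :
    ∃ r : ℕ, (ρ.node ^ r) j = i := by
  obtain ⟨r, rfl⟩ := h
  refine ⟨r * (ρ.period - 1), ?_⟩
  rw [← Perm.mul_apply, ← pow_add, ← Nat.mul_succ, Nat.succ_eq_add_one,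
    Nat.sub_add_cancel ρ.period_pos, mul_comm, pow_mul, node_pow_period, one_pow]
  rfl

/-- Processes that perform a transition at `j` and one at `i`, in any order, and symmetrically
on the orbits of `j` and `i`. The two flags tell which of the transitions have been done. -/
theorem exists_family {C : Network k} (hC : ρ.Equivariant C) {i j : Fin k} {α β : Action}
    {Q R : Proc} (hα : Trans (C j) α Q) (hβ : Trans (C i) β R)
    (hdia : ∀ r : ℕ, (ρ.node ^ r) i = j → ∃ T, Trans Q (β.map (ρ.name ^ r : Perm Name)) T ∧
      Trans (R.map (ρ.name ^ r : Perm Name)) α T) :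
    ∃ N : Bool → Bool → Network k, N false false = C ∧ (∀ b c, ρ.Equivariant (N b c)) ∧
      (∀ c, Trans (N false c j) α (N true c j)) ∧ ∀ b, Trans (N b false i) β (N b true i) := by
  have hi := ρ.equivariant_spread hC i R
  have hj := ρ.equivariant_spread hC j Q
  -- If the orbits coincide, every node plays both roles and the diamond provides the common outcome
  -- `T`. Otherwise the roles never meet in one component.
  by_cases h : ∃ r : ℕ, (ρ.node ^ r) i = j
  · obtain ⟨r', hr'⟩ := ρ.exists_pow_symm h
    obtain ⟨r, hr⟩ := h
    obtain ⟨T, h₁, h₂⟩ := hdia r hr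
    refine ⟨fun b c => match b, c with
      | false, false => C
      | true, false => ρ.spread C j Q
      | false, true => ρ.spread C i R
      | true, true => ρ.spread C j T, rfl, ?_, ?_, ?_⟩
    · rintro (_ | _) (_ | _)
      exacts [hC, hi, hj, ρ.equivariant_spread hC j T]
    · rintro (_ | _)
      · simpa only [spread_self] using hα
      · have := ρ.spread_pow C i R r
        rw [hr] at this
        simpa only [spread_self, this] using h₂
    · rintro (_ | _)
      · simpa only [spread_self] using hβ
      · have e₁ := ρ.spread_pow C j Q r'
        have e₂ := ρ.spread_pow C j T r'
        rw [hr'] at e₁ e₂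
        simp only [e₁, e₂]
        -- Rotation carries this move from `j` back to `i`; the exponents `r` and `r'` add up to a
        -- power fixing `i`, so the label becomes `β` again.
        have := h₁.map (ρ.name ^ r').injective
        rwa [Action.map_map, ← Perm.coe_mul, ← pow_add, (ρ.free (r' + r) i (by
          rw [pow_add, Perm.mul_apply, hr, hr'])).2, Perm.coe_one, Action.map_id] at this
  · have h' : ¬ ∃ r : ℕ, (ρ.node ^ r) j = i := fun h' => h (ρ.exists_pow_symm h')
    refine ⟨fun b c => match b, c with
      | false, false => C
      | true, false => ρ.spread C j Q
      | false, true => ρ.spread C i R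
      | true, true => ρ.spread (ρ.spread C i R) j Q, rfl, ?_, ?_, ?_⟩
    · rintro (_ | _) (_ | _)
      exacts [hC, hi, hj, ρ.equivariant_spread hi j Q]
    · rintro (_ | _)
      · simpa only [spread_self] using hα
      · simpa only [spread_self, ρ.spread_of_not R h] using hα
    · rintro (_ | _)
      · simpa only [spread_self] using hβ
      · simpa only [spread_self, ρ.spread_of_not Q h'] using hβ

open Classical in
/-- Whether the `l`-th node is among the first `r` nodes of the orbit of `j`. -/
noncomputable def reached (j : Fin k) (r : ℕ) (l : Fin k) : Bool :=
  decide (∃ s < r, (ρ.node ^ s) j = l)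

theorem reached_zero (j l : Fin k) : ρ.reached j 0 l = false := by simp [reached]

theorem reached_succ_self (j : Fin k) (r : ℕ) :
    ρ.reached j (r + 1) ((ρ.node ^ r) j) = true := by
  simp only [reached, decide_eq_true_eq]
  exact ⟨r, Nat.lt_succ_self r, rfl⟩

theorem reached_succ_of_ne {j l : Fin k} {r : ℕ} (h : l ≠ (ρ.node ^ r) j) :
    ρ.reached j (r + 1) l = ρ.reached j r l := by
  simp only [reached, decide_eq_decide]
  constructor
  · rintro ⟨s, hs, rfl⟩
    exact ⟨s, lt_of_le_of_ne (Nat.lt_succ_iff.1 hs) (by rintro rfl; exact h rfl), rfl⟩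
  · rintro ⟨s, hs, h⟩
    exact ⟨s, by omega, h⟩

theorem reached_self {r : ℕ} (hr : r < ρ.period) (j : Fin k) :
    ρ.reached j r ((ρ.node ^ r) j) = false := by
  simp only [reached, decide_eq_false_iff_not]
  rintro ⟨s, hs, h⟩
  exact ρ.node_pow_ne hs hr j h

/-- After a full period the reached nodes form a whole orbit. This is what restores invariance at
the end of a round. -/
theorem reached_period (j l : Fin k) :
    ρ.reached j ρ.period (ρ.node l) = ρ.reached j ρ.period l := by
  simp only [reached, decide_eq_decide]
  exact exists_pow_lt_apply_iff ρ.period_pos ρ.node_pow_period _ _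

/-- The components after `r` steps of a round. -/
noncomputable def stage (N : Bool → Bool → Network k) (j i : Fin k) (r : ℕ) : Network k :=
  fun l => N (ρ.reached j r l) (ρ.reached i r l) l

theorem stage_zero (N : Bool → Bool → Network k) (j i : Fin k) :
    ρ.stage N j i 0 = N false false := by
  funext l; simp only [stage, reached_zero]

theorem equivariant_stage {N : Bool → Bool → Network k} (hN : ∀ b c, ρ.Equivariant (N b c))
    (j i : Fin k) : ρ.Equivariant (ρ.stage N j i ρ.period) := by
  intro l
  simp only [stage, reached_period]
  exact hN _ _ l

theorem stage_succ_pair (N : Bool → Bool → Network k) {i j : Fin k} (hij : i ≠ j) (r : ℕ) :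
    ρ.stage N j i (r + 1) = Function.update (Function.update (ρ.stage N j i r) ((ρ.node ^ r) i)
        (N (ρ.reached j r ((ρ.node ^ r) i)) true ((ρ.node ^ r) i))) ((ρ.node ^ r) j)
        (N true (ρ.reached i r ((ρ.node ^ r) j)) ((ρ.node ^ r) j)) := by
  have hne : (ρ.node ^ r) i ≠ (ρ.node ^ r) j := (ρ.node ^ r).injective.ne hij
  funext l
  by_cases hj : l = (ρ.node ^ r) j
  · subst hj
    rw [Function.update_self, stage, reached_succ_self, ρ.reached_succ_of_ne hne.symm]
  rw [Function.update_of_ne hj]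
  by_cases hi : l = (ρ.node ^ r) i
  · subst hi
    rw [Function.update_self, stage, reached_succ_self, ρ.reached_succ_of_ne hne]
  rw [Function.update_of_ne hi, stage, ρ.reached_succ_of_ne hj, ρ.reached_succ_of_ne hi, stage]

theorem stage_succ_single (M : Bool → Network k) (j : Fin k) (r : ℕ) :
    ρ.stage (fun b _ => M b) j j (r + 1) =
      Function.update (ρ.stage (fun b _ => M b) j j r) ((ρ.node ^ r) j)
        (M true ((ρ.node ^ r) j)) := by
  funext l
  by_cases hj : l = (ρ.node ^ r) j
  · subst hj
    rw [Function.update_self, stage, reached_succ_self]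
  · rw [Function.update_of_ne hj, stage, ρ.reached_succ_of_ne hj, stage]

/-- The set of private names is invariant under the rotation and contains no name used in an
election. -/
structure Admissible (t : Finset Name) : Prop where
  name_mem : ∀ a, ρ.name a ∈ t ↔ a ∈ t
  o_notMem : Name.o ∉ t
  node_notMem : ∀ i : Fin k, nodeName i ∉ t

/-- The state is invariant under the rotation. -/
structure Symmetric (S : State k) : Prop where
  comp : ρ.Equivariant S.comp
  top : ρ.Admissible S.top

variable {ρ}

theorem Admissible.pow_mem {t : Finset Name} (h : ρ.Admissible t) (r : ℕ) (a : Name) :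
    (ρ.name ^ r) a ∈ t ↔ a ∈ t := by
  induction r with
  | zero => rfl
  | succ r ih => rw [pow_succ', Perm.mul_apply, h.name_mem, ih]

theorem mem_image_pow_apply (i : Fin k) (y a : Name) :
    ρ.name a ∈ (Finset.range ρ.period).image (fun s => (ρ.name ^ s) y) ↔
      a ∈ (Finset.range ρ.period).image (fun s => (ρ.name ^ s) y) := by
  simp only [Finset.mem_image, Finset.mem_range]
  exact exists_pow_lt_apply_iff ρ.period_pos (ρ.name_pow_period i) y a

end Rotation

/-- The action declares no leader. -/
def NonElecting (k : ℕ) (μ : Action) : Prop := ∀ n : Fin k, μ ≠ .out .o (nodeName n)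

/-- A transition of the network in which no component declares a leader. -/
def Silent (S S' : State k) : Prop :=
  ∃ μ c, Step S μ c S' ∧ ∀ i μ', c i = some μ' → NonElecting k μ'

theorem contrib_single {i l : Fin k} {μ μ' : Action} (h : NonElecting k μ)
    (h' : Function.update (fun _ => none) i (some μ) l = some μ') : NonElecting k μ' := by
  by_cases hl : l = i
  · subst hl
    rw [Function.update_self] at h'
    exact Option.some.inj h' ▸ h
  · rw [Function.update_of_ne hl] at h'
    cases h'

theorem contrib_pair {i j l : Fin k} {μ ν μ' : Action} (h : NonElecting k μ)
    (hν : NonElecting k ν)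
    (h' : Function.update (Function.update (fun _ => none) i (some μ)) j (some ν) l =
      some μ') : NonElecting k μ' := by
  by_cases hl : l = j
  · subst hl
    rw [Function.update_self] at h'
    exact Option.some.inj h' ▸ hν
  · rw [Function.update_of_ne hl] at h'
    exact contrib_single h h'

/-- A component that sends a name on a public channel to the environment. -/
theorem Step.exists_output (S : State k) {i : Fin k} {x y : Name} {Q : Proc}
    (h : Trans (S.comp i) (.out x y) Q) (hx : x ∉ S.top) :
    ∃ μ, Step S μ (Function.update (fun _ => none) i (some (.out x y)))
      ⟨S.top.erase y, Function.update S.comp i Q⟩ := by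
  by_cases hy : y ∈ S.top
  · exact ⟨_, .extrude S i x y Q h hx hy⟩
  · rw [Finset.erase_eq_of_notMem hy]
    refine ⟨_, .par S i _ Q h (by simp [Action.bn]) ?_⟩
    rw [Set.disjoint_left]
    rintro a (rfl | rfl)
    exacts [hx, hy]

/-- The extruded name is never free in `P`, so exchanging it with another name not free in `P`
leaves the source unchanged. -/
theorem Trans.exists_bout {P Q : Proc} {x y : Name} (h : Trans P (.bout x y) Q) {z : Name}
    (hz : z ∉ P.fn) : ∃ R, Trans P (.bout x z) R := by
  have hy := h.bout_notMem
  have hx := h.bout_subject_mem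
  have := h.map (Equiv.swap y z).injective
  rw [Tm.map_of_fixed fun a ha => Equiv.swap_apply_of_ne_of_ne (by rintro rfl; exact hy ha)
    (by rintro rfl; exact hz ha), Action.map, Equiv.swap_apply_left,
    Equiv.swap_apply_of_ne_of_ne (by rintro rfl; exact hy hx) (by rintro rfl; exact hz hx)] at this
  exact ⟨_, this⟩

theorem Trans.exists_inp {P Q : Proc} {x y : Name} (h : Trans P (.inp x y) Q) (hy : y ∉ P.fn)
    {z : Name} (hz : z ∉ P.fn) : ∃ R, Trans P (.inp x z) R := by
  have hx := h.inp_subject_mem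
  have := h.map (Equiv.swap y z).injective
  rw [Tm.map_of_fixed fun a ha => Equiv.swap_apply_of_ne_of_ne (by rintro rfl; exact hy ha)
    (by rintro rfl; exact hz ha), Action.map, Equiv.swap_apply_left,
    Equiv.swap_apply_of_ne_of_ne (by rintro rfl; exact hy hx) (by rintro rfl; exact hz hx)] at this
  exact ⟨_, this⟩

namespace Rotation

variable {ρ} {S : State k}

theorem Equivariant.trans_pow {N N' : Network k} (hN : ρ.Equivariant N) (hN' : ρ.Equivariant N')
    {j : Fin k} {α : Action} (h : Trans (N j) α (N' j)) (r : ℕ) :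
    Trans (N ((ρ.node ^ r) j)) (α.map (ρ.name ^ r : Perm Name)) (N' ((ρ.node ^ r) j)) := by
  rw [hN.pow, hN'.pow]
  exact h.map (ρ.name ^ r).injective

/-- The turns of a round are concatenated. Positivity of the period ensures that at least one
transition is made, without which no infinite computation could be built. -/
theorem exists_symmetric_of_stage {N : Bool → Bool → Network k} {j i : Fin k}
    {top : ℕ → Finset Name} (hN₀ : N false false = S.comp) (hN : ∀ b c, ρ.Equivariant (N b c)) (ht₀ : top 0 = S.top)
    (ht : ρ.Admissible (top ρ.period))
    (hstep : ∀ r < ρ.period, Silent ⟨top r, ρ.stage N j i r⟩ ⟨top (r + 1), ρ.stage N j i (r + 1)⟩) :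
    ∃ S', TransGen Silent S S' ∧ ρ.Symmetric S' := by
  have h₀ : (⟨top 0, ρ.stage N j i 0⟩ : State k) = S := by
    rw [ht₀, stage_zero, hN₀]
  have key : ∀ r < ρ.period, TransGen Silent S ⟨top (r + 1), ρ.stage N j i (r + 1)⟩ := by
    intro r
    induction r with
    | zero => intro hr; have := hstep 0 hr; rw [h₀] at this; exact .single this
    | succ r ih => intro hr; exact (ih (by omega)).tail (hstep _ hr)
  have := key (ρ.period - 1) (by have := ρ.period_pos; omega)
  rw [Nat.sub_add_cancel ρ.period_pos] at this
  exact ⟨_, this, ρ.equivariant_stage hN j i, ht⟩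

/-- The free names that the components can have after `r` steps of a round. -/
def FnBound (ρ : Rotation k) (S : State k) (x y : Name) (r : ℕ) (C : Network k) : Prop :=
  ∀ l, ∀ a ∈ (C l).fn, a ∈ (S.comp l).fn ∨ ∃ s < r, a = (ρ.name ^ s) x ∨ a = (ρ.name ^ s) y

theorem FnBound.succ {x y : Name} {r : ℕ} {C C' : Network k} (h : ρ.FnBound S x y r C)
    (h' : ∀ l, ∀ a ∈ (C' l).fn, a ∈ (C l).fn ∨ a = (ρ.name ^ r) x ∨ a = (ρ.name ^ r) y) :
    ρ.FnBound S x y (r + 1) C' := by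
  intro l a ha
  rcases h' l a ha with ha | ha
  · exact (h l a ha).imp (fun h => h) fun ⟨s, hs, h⟩ => ⟨s, by omega, h⟩
  · exact .inr ⟨r, by omega, ha⟩

/-- All nodes of the orbit of `j` make the same transition. -/
theorem Symmetric.round_single (hS : ρ.Symmetric S)
    (hcap : ∀ i α Q, Trans (S.comp i) α Q → NonElecting k α)
    {j : Fin k} {α : Action} {Q : Proc} (h : Trans (S.comp j) α Q)
    {x y : Name} (hα : α ≠ .tau → α.names ⊆ {x, y})
    {top : ℕ → Finset Name} (ht₀ : top 0 = S.top) (ht : ρ.Admissible (top ρ.period))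
    (hstep : ∀ r < ρ.period, ∀ C Q', (α ≠ .tau → ρ.FnBound S x y r C) →
      Trans (C ((ρ.node ^ r) j)) (α.map (ρ.name ^ r : Perm Name)) Q' →
      ∃ μ, Step ⟨top r, C⟩ μ (Function.update (fun _ => none) ((ρ.node ^ r) j)
        (some (α.map (ρ.name ^ r : Perm Name))))
        ⟨top (r + 1), Function.update C ((ρ.node ^ r) j) Q'⟩) :
    ∃ S', TransGen Silent S S' ∧ ρ.Symmetric S' := by
  let M : Bool → Network k := fun b => if b then ρ.spread S.comp j Q else S.comp
  have hM : ∀ b, ρ.Equivariant (M b) := by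
    rintro (_ | _)
    exacts [hS.comp, ρ.equivariant_spread hS.comp j Q]
  have hT : ∀ r, Trans (M false ((ρ.node ^ r) j)) (α.map (ρ.name ^ r : Perm Name))
      (M true ((ρ.node ^ r) j)) := by
    refine (hM false).trans_pow (hM true) ?_
    have : M true j = Q := ρ.spread_self _ _ _
    rw [this]
    exact h
  have hT' : ∀ r < ρ.period, Trans (ρ.stage (fun b _ => M b) j j r ((ρ.node ^ r) j))
      (α.map (ρ.name ^ r : Perm Name)) (M true ((ρ.node ^ r) j)) := fun r hr => by
    rw [stage, ρ.reached_self hr]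
    exact hT r
  have hfn : α ≠ .tau → ∀ r ≤ ρ.period, ρ.FnBound S x y r (ρ.stage (fun b _ => M b) j j r) := by
    intro hτ r
    induction r with
    | zero => intro _ l a ha; rw [stage_zero] at ha; exact .inl ha
    | succ r ih =>
      intro hr
      refine (ih (by omega)).succ fun l a ha => ?_
      rw [stage_succ_single] at ha
      by_cases hl : l = (ρ.node ^ r) j
      · subst hl
        rw [Function.update_self] at ha
        refine ((hT' r hr).fn_target (Action.map_ne_tau _ hτ) a ha).imp
          (fun h => h) fun h => ?_
        rw [Action.names_map] at h
        obtain ⟨b, hb, rfl⟩ := h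
        exact (hα hτ hb).imp (congrArg (ρ.name ^ r : Perm Name))
          (congrArg (ρ.name ^ r : Perm Name))
      · rw [Function.update_of_ne hl] at ha
        exact .inl ha
  refine exists_symmetric_of_stage (N := fun b _ => M b) (j := j) (i := j) rfl (fun b _ => hM b)
    ht₀ ht fun r hr => ?_
  obtain ⟨μ, hμ⟩ := hstep r hr _ _ (fun hτ => hfn hτ r hr.le) (hT' r hr)
  rw [stage_succ_single]
  exact ⟨μ, _, hμ, fun i μ' => contrib_single (hcap _ _ _ (hT r))⟩

/-- All pairs in the orbit of `(i, j)` make the same communication. -/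
theorem Symmetric.round_pair (hS : ρ.Symmetric S)
    (hcap : ∀ i α Q, Trans (S.comp i) α Q → NonElecting k α)
    {i j : Fin k} (hij : i ≠ j) {α β : Action} {Q R : Proc} (hα : Trans (S.comp j) α Q)
    (hβ : Trans (S.comp i) β R)
    (hdia : ∀ r : ℕ, (ρ.node ^ r) i = j → ∃ T, Trans Q (β.map (ρ.name ^ r : Perm Name)) T ∧
      Trans (R.map (ρ.name ^ r : Perm Name)) α T)
    {x y : Name} (hατ : α ≠ .tau) (hβτ : β ≠ .tau) (hαn : α.names ⊆ {x, y})
    (hβn : β.names ⊆ {x, y})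
    {top : ℕ → Finset Name} (ht₀ : top 0 = S.top) (ht : ρ.Admissible (top ρ.period))
    (hstep : ∀ r < ρ.period, ∀ C Q' R', ρ.FnBound S x y r C →
      Trans (C ((ρ.node ^ r) j)) (α.map (ρ.name ^ r : Perm Name)) Q' →
      Trans (C ((ρ.node ^ r) i)) (β.map (ρ.name ^ r : Perm Name)) R' →
      ∃ μ, Step ⟨top r, C⟩ μ (Function.update (Function.update (fun _ => none) ((ρ.node ^ r) i)
          (some (β.map (ρ.name ^ r : Perm Name)))) ((ρ.node ^ r) j)
          (some (α.map (ρ.name ^ r : Perm Name))))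
        ⟨top (r + 1),
          Function.update (Function.update C ((ρ.node ^ r) i) R') ((ρ.node ^ r) j) Q'⟩) :
    ∃ S', TransGen Silent S S' ∧ ρ.Symmetric S' := by
  obtain ⟨N, hN₀, hN, hNα, hNβ⟩ := ρ.exists_family hS.comp hα hβ hdia
  have hTα : ∀ r < ρ.period, Trans (ρ.stage N j i r ((ρ.node ^ r) j))
      (α.map (ρ.name ^ r : Perm Name))
      (N true (ρ.reached i r ((ρ.node ^ r) j)) ((ρ.node ^ r) j)) := fun r hr => by
    rw [stage, ρ.reached_self hr]
    exact (hN _ _).trans_pow (hN _ _) (hNα _) r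
  have hTβ : ∀ r < ρ.period, Trans (ρ.stage N j i r ((ρ.node ^ r) i))
      (β.map (ρ.name ^ r : Perm Name))
      (N (ρ.reached j r ((ρ.node ^ r) i)) true ((ρ.node ^ r) i)) := fun r hr => by
    rw [stage, ρ.reached_self hr]
    exact (hN _ _).trans_pow (hN _ _) (hNβ _) r
  have hnames : ∀ {γ : Action} {r : ℕ} {a : Name}, γ.names ⊆ {x, y} →
      a ∈ (γ.map (ρ.name ^ r : Perm Name)).names → a = (ρ.name ^ r) x ∨ a = (ρ.name ^ r) y := by
    intro γ r a hγ h
    rw [Action.names_map] at h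
    obtain ⟨b, hb, rfl⟩ := h
    exact (hγ hb).imp (congrArg (ρ.name ^ r : Perm Name))
          (congrArg (ρ.name ^ r : Perm Name))
  have hfn : ∀ r ≤ ρ.period, ρ.FnBound S x y r (ρ.stage N j i r) := by
    intro r
    induction r with
    | zero => intro _ l a ha; rw [stage_zero, hN₀] at ha; exact .inl ha
    | succ r ih =>
      intro hr
      refine (ih (by omega)).succ fun l a ha => ?_
      rw [ρ.stage_succ_pair N hij] at ha
      by_cases hj : l = (ρ.node ^ r) j
      · subst hj
        rw [Function.update_self] at ha
        exact ((hTα r hr).fn_target (Action.map_ne_tau _ hατ) a ha).imp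
          (fun h => h) (hnames hαn)
      rw [Function.update_of_ne hj] at ha
      by_cases hi : l = (ρ.node ^ r) i
      · subst hi
        rw [Function.update_self] at ha
        exact ((hTβ r hr).fn_target (Action.map_ne_tau _ hβτ) a ha).imp
          (fun h => h) (hnames hβn)
      · rw [Function.update_of_ne hi] at ha
        exact .inl ha
  refine exists_symmetric_of_stage (N := N) (j := j) (i := i) hN₀ hN ht₀ ht fun r hr => ?_
  obtain ⟨μ, hμ⟩ := hstep r hr _ _ _ (hfn r hr.le) (hTα r hr) (hTβ r hr)
  rw [ρ.stage_succ_pair N hij]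
  -- A node may have played its other role before its turn, but the rotated label is already offered
  -- in `S`, where `hcap` excludes declarations.
  have hα' := (hN false false).trans_pow (hN true false) (hNα false) r
  have hβ' := (hN false false).trans_pow (hN false true) (hNβ false) r
  rw [hN₀] at hα' hβ'
  exact ⟨μ, _, hμ, fun i μ' => contrib_pair (hcap _ _ _ hβ') (hcap _ _ _ hα')⟩

end Rotation

end AsyncPi

/-! ### Rounds for each kind of transition, and the conflict between leaders. -/

namespace AsyncPi

open Equiv (Perm)
open Relation (ReflTransGen TransGen)

variable {k : ℕ}

namespace Rotation

variable {ρ : Rotation k} {S : State k}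

theorem Admissible.disjoint_map {t : Finset Name} (h : ρ.Admissible t) {α : Action}
    (hd : Disjoint α.names (t : Set Name)) (r : ℕ) :
    Disjoint (α.map (ρ.name ^ r : Perm Name)).names (t : Set Name) := by
  rw [Action.names_map, Set.disjoint_left]
  rintro _ ⟨a, ha, rfl⟩ h'
  exact Set.disjoint_left.1 hd ha ((h.pow_mem r a).1 h')

theorem Admissible.sdiff {t : Finset Name} (h : ρ.Admissible t) (i : Fin k) (y : Name) :
    ρ.Admissible (t \ (Finset.range ρ.period).image fun s => (ρ.name ^ s) y) where
  name_mem a := by rw [Finset.mem_sdiff, Finset.mem_sdiff, mem_image_pow_apply i, h.name_mem]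
  o_notMem h' := h.o_notMem (Finset.mem_sdiff.1 h').1
  node_notMem n h' := h.node_notMem n (Finset.mem_sdiff.1 h').1

theorem Admissible.union {t : Finset Name} (h : ρ.Admissible t) (i : Fin k) {y : Name}
    (ho : ∀ r, (ρ.name ^ r) y ≠ .o) (hn : ∀ (r : ℕ) (n : Fin k), (ρ.name ^ r) y ≠ nodeName n) :
    ρ.Admissible (t ∪ (Finset.range ρ.period).image fun s => (ρ.name ^ s) y) where
  name_mem a := by rw [Finset.mem_union, Finset.mem_union, mem_image_pow_apply i, h.name_mem]
  o_notMem h' := by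
    rcases Finset.mem_union.1 h' with h' | h'
    · exact h.o_notMem h'
    · obtain ⟨r, _, h'⟩ := Finset.mem_image.1 h'
      exact ho r h'
  node_notMem n h' := by
    rcases Finset.mem_union.1 h' with h' | h'
    · exact h.node_notMem n h'
    · obtain ⟨r, _, h'⟩ := Finset.mem_image.1 h'
      exact hn r n h'

/-- A round in which the orbit of `j` sends names to the environment. -/
theorem Symmetric.round_output (hS : ρ.Symmetric S)
    (hcap : ∀ i α Q, Trans (S.comp i) α Q → NonElecting k α)
    {j : Fin k} {x y : Name} {Q : Proc} (h : Trans (S.comp j) (.out x y) Q) (hx : x ∉ S.top) :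
    ∃ S', TransGen Silent S S' ∧ ρ.Symmetric S' := by
  -- Sending a restricted name lifts its restriction, so the first `r` rotations of `y` have left
  -- the top level after `r` turns. If `y` is public, so are its rotations, and the difference
  -- removes nothing.
  refine hS.round_single hcap h (x := x) (y := y) (fun _ => subset_rfl)
    (top := fun r => S.top \ (Finset.range r).image fun s => (ρ.name ^ s) y) (by simp)
    (hS.top.sdiff j y) fun r _ C Q' _ h' => ?_
  obtain ⟨μ, hμ⟩ := Step.exists_output
    ⟨S.top \ (Finset.range r).image fun s => (ρ.name ^ s) y, C⟩ h' fun hm =>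
      hx ((hS.top.pow_mem r x).1 (Finset.mem_sdiff.1 hm).1)
  refine ⟨μ, ?_⟩
  rw [Finset.range_add_one, Finset.image_insert, Finset.sdiff_insert]
  exact hμ

theorem exists_fresh_supply (ρ : Rotation k) (S : State k) :
    ∃ q, ∀ i, (∀ l, ρ.supply (q, i) ∉ (S.comp l).fn) ∧ ρ.supply (q, i) ∉ S.top ∧
      ρ.supply (q, i) ≠ .o ∧ ∀ n : Fin k, ρ.supply (q, i) ≠ nodeName n := by
  obtain ⟨q, hq⟩ := ρ.exists_supply ((Set.finite_iUnion fun l => (S.comp l).fn_finite).union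
    (S.top.finite_toSet.union ((Set.finite_singleton Name.o).union
      (Set.finite_range (nodeName (k := k))))))
  refine ⟨q, fun i => ?_⟩
  have h := hq i
  simp only [Set.mem_union, Set.mem_iUnion, Set.mem_singleton_iff, Set.mem_range, not_or,
    not_exists, Finset.mem_coe] at h
  exact ⟨h.1, h.2.1, h.2.2.1, fun n hn => h.2.2.2 n hn.symm⟩

/-- Freshness of the name extruded at turn `r`: it avoids the names of `S`, among them the rotations
of `x` by equivariance, and the names extruded earlier belong to other nodes. -/
theorem FnBound.supply_notMem (hS : ρ.Equivariant S.comp) {q : ℕ} {j : Fin k} {x : Name}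
    (hq : ∀ i l, ρ.supply (q, i) ∉ (S.comp l).fn) (hx : x ∈ (S.comp j).fn) {r : ℕ}
    (hr : r < ρ.period) {C : Network k} (h : ρ.FnBound S x (ρ.supply (q, j)) r C) (l : Fin k) :
    (ρ.name ^ r) (ρ.supply (q, j)) ∉ (C l).fn := by
  intro hm
  rcases h l _ hm with h | ⟨s, hs, h | h⟩
  · rw [name_pow_supply] at h
    exact hq _ _ h
  · rw [name_pow_supply] at h
    refine hq ((ρ.node ^ r) j) ((ρ.node ^ s) j) ?_
    rw [h, hS.pow, Tm.fn_map]
    exact ⟨x, hx, rfl⟩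
  · rw [name_pow_supply, name_pow_supply] at h
    exact ρ.node_pow_ne hs hr j (congrArg Prod.snd (ρ.supply_injective h)).symm

/-- A round in which the orbit of `j` sends private names to the environment. -/
theorem Symmetric.round_bout (hS : ρ.Symmetric S)
    (hcap : ∀ i α Q, Trans (S.comp i) α Q → NonElecting k α)
    {j : Fin k} {x y : Name} {Q : Proc} (h : Trans (S.comp j) (.bout x y) Q) (hx : x ∉ S.top) :
    ∃ S', TransGen Silent S S' ∧ ρ.Symmetric S' := by
  -- The given private name may behave badly under rotation. It is replaced by the name of `j` in an
  -- unused copy of the nodes, whose rotations within the round are distinct.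
  obtain ⟨q, hq⟩ := ρ.exists_fresh_supply S
  obtain ⟨Q₁, h₁⟩ := h.exists_bout ((hq j).1 j)
  refine hS.round_single hcap h₁ (x := x) (y := ρ.supply (q, j)) (fun _ => subset_rfl)
    (top := fun _ => S.top) rfl hS.top fun r hr C Q' hfn h' => ?_
  have hfresh := (hfn (by simp)).supply_notMem hS.comp (fun i => (hq i).1) h.bout_subject_mem hr
  refine ⟨_, .par ⟨S.top, C⟩ _ _ _ h' (fun l _ => ?_) (hS.top.disjoint_map ?_ r)⟩
  · exact Set.disjoint_singleton_left.2 (hfresh l)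
  · rw [Set.disjoint_left]
    rintro a (rfl | rfl)
    exacts [hx, (hq j).2.1]

theorem Equivariant.trans_of_pow_eq {C : Network k} (hC : ρ.Equivariant C) {i j : Fin k} {r : ℕ}
    (h : (ρ.node ^ r) i = j) {α : Action} {Q : Proc} (hα : Trans (C i) α Q) :
    Trans (C j) (α.map (ρ.name ^ r : Perm Name)) (Q.map (ρ.name ^ r : Perm Name)) := by
  rw [← h, hC.pow]
  exact hα.map (ρ.name ^ r).injective

/-- A round in which the orbit of `j` sends names to the orbit of `i`. -/
theorem Symmetric.round_com (hS : ρ.Symmetric S)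
    (hcap : ∀ i α Q, Trans (S.comp i) α Q → NonElecting k α)
    {i j : Fin k} (hij : i ≠ j) {x y : Name} {Q R : Proc} (hβ : Trans (S.comp i) (.inp x y) R)
    (hα : Trans (S.comp j) (.out x y) Q) :
    ∃ S', TransGen Silent S S' ∧ ρ.Symmetric S' := by
  refine hS.round_pair hcap hij hα hβ
    (fun r hr => hα.out_inp_diamond (hS.comp.trans_of_pow_eq hr hβ))
    (x := x) (y := y) (by simp) (by simp) subset_rfl subset_rfl
    (top := fun _ => S.top) rfl hS.top fun r hr C Q' R' _ h₁ h₂ => ?_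
  exact ⟨_, .com ⟨S.top, C⟩ _ _ _ _ R' Q' ((ρ.node ^ r).injective.ne hij) h₂ h₁⟩

/-- A round in which the orbit of `j` sends private names to the orbit of `i`. -/
theorem Symmetric.round_close (hS : ρ.Symmetric S)
    (hcap : ∀ i α Q, Trans (S.comp i) α Q → NonElecting k α)
    {i j : Fin k} (hij : i ≠ j) {x y : Name} {Q R : Proc} (hβ : Trans (S.comp i) (.inp x y) R)
    (hα : Trans (S.comp j) (.bout x y) Q) (hy : y ∉ (S.comp i).fn) :
    ∃ S', TransGen Silent S S' ∧ ρ.Symmetric S' := by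
  obtain ⟨q, hq⟩ := ρ.exists_fresh_supply S
  obtain ⟨Q₁, hα₁⟩ := hα.exists_bout ((hq j).1 j)
  obtain ⟨R₁, hβ₁⟩ := hβ.exists_inp hy ((hq j).1 i)
  refine hS.round_pair hcap hij hα₁ hβ₁
    (fun r hr => hα₁.bout_inp_diamond (hS.comp.trans_of_pow_eq hr hβ₁) fun h => hij ?_)
    (x := x) (y := ρ.supply (q, j)) (by simp) (by simp) subset_rfl subset_rfl
    (top := fun r => S.top ∪ (Finset.range r).image fun s => (ρ.name ^ s) (ρ.supply (q, j)))
    (by simp) (hS.top.union j ?_ ?_) fun r hr C Q' R' hfn h₁ h₂ => ?_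
  -- Were the rotated received name equal to the extruded one, `node ^ r` would fix `j`, hence be
  -- trivial, although it maps `i` to `j ≠ i`.
  · rw [name_pow_supply] at h
    have := (ρ.free r j (congrArg Prod.snd (ρ.supply_injective h))).1
    rwa [this] at hr
  · intro r; rw [name_pow_supply]; exact (hq _).2.2.1
  · intro r; rw [name_pow_supply]; exact (hq _).2.2.2
  · have hfresh := hfn.supply_notMem hS.comp (fun i => (hq i).1) hα.bout_subject_mem hr
    refine ⟨.tau, ?_⟩
    rw [Finset.range_add_one, Finset.image_insert, Finset.union_insert]
    refine .close ⟨_, C⟩ _ _ _ _ R' Q' ((ρ.node ^ r).injective.ne hij) h₂ h₁ hfresh ?_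
    rw [Finset.mem_union, Finset.mem_image]
    rintro (h | ⟨s, hs, h⟩)
    · rw [name_pow_supply] at h
      exact (hq _).2.1 h
    · rw [name_pow_supply, name_pow_supply] at h
      exact ρ.node_pow_ne (Finset.mem_range.1 hs) hr j (congrArg Prod.snd (ρ.supply_injective h))

/-- If a symmetric state has a transition then it can reach another symmetric state. -/
theorem Symmetric.exists_round (hS : ρ.Symmetric S)
    (hcap : ∀ i α Q, Trans (S.comp i) α Q → NonElecting k α)
    {μ : Action} {c : Fin k → Option Action} {S₁ : State k} (h : Step S μ c S₁) :
    ∃ S', TransGen Silent S S' ∧ ρ.Symmetric S' := by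
  cases h with
  | par i μ Q ht _ hd =>
    cases μ with
    | inp x y =>
      exact hS.round_single hcap ht (x := x) (y := y) (fun _ => subset_rfl)
        (top := fun _ => S.top) rfl hS.top fun r _ C Q' _ h' =>
          ⟨_, .par ⟨S.top, C⟩ _ _ Q' h' (by simp [Action.map, Action.bn])
            (hS.top.disjoint_map hd r)⟩
    | tau =>
      exact hS.round_single hcap ht (x := .o) (y := .o) (fun h => absurd rfl h)
        (top := fun _ => S.top) rfl hS.top fun r _ C Q' _ h' =>
          ⟨_, .par ⟨S.top, C⟩ _ _ Q' h' (by simp [Action.map, Action.bn])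
            (hS.top.disjoint_map hd r)⟩
    | out x y =>
      exact hS.round_output hcap ht fun h => Set.disjoint_left.1 hd (.inl rfl) h
    | bout x y =>
      exact hS.round_bout hcap ht fun h => Set.disjoint_left.1 hd (.inl rfl) h
  | extrude i x y Q ht hx _ => exact hS.round_output hcap ht hx
  | com i j x y Q R hij h₁ h₂ => exact hS.round_com hcap hij h₁ h₂
  | close i j x y Q R hij h₁ h₂ hy _ => exact hS.round_close hcap hij h₁ h₂ (hy i)

/-- A symmetric state in which a component can declare a leader can also reach, in two steps,
a conflict. -/
theorem Symmetric.exists_conflict (hS : ρ.Symmetric S) {i n : Fin k} {Q : Proc}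
    (h : Trans (S.comp i) (.out .o (nodeName n)) Q) :
    ∃ c S₁ c' S₂, Step S (.out .o (nodeName n)) c S₁ ∧
      Step S₁ (.out .o (nodeName (ρ.node n))) c' S₂ := by
  have hd : ∀ n : Fin k, Disjoint (Action.out .o (nodeName n)).names (S.top : Set Name) := by
    intro n
    rw [Set.disjoint_left]
    rintro a (rfl | rfl)
    exacts [hS.top.o_notMem, hS.top.node_notMem n]
  refine ⟨_, _, _, _, .par S i _ Q h (by simp [Action.bn]) (hd n),
    .par _ (ρ.node i) _ (Q.map ρ.name) ?_ (by simp [Action.bn]) (hd _)⟩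
  have h' := h.map ρ.name.injective
  rw [Action.map, ρ.name_o, ρ.name_node] at h'
  change Trans (Function.update S.comp i Q (ρ.node i)) _ _
  -- No node is fixed, so the first declaration has left the component at `ρ.node i` untouched.
  rw [Function.update_of_ne (ρ.node_ne i), hS.comp]
  exact h'

end Rotation

/-! ### Computations and the infinite run without a leader. -/

namespace Computation

variable {P : Network k}

theorem Contains.of_extends {C C' : Computation P} (h : C.Extends C') {μ : Action}
    (hC : C.Contains μ) : C'.Contains μ := by
  obtain ⟨m, hm, rfl⟩ := hC
  exact ⟨m, hm.trans_le h.1, (h.2.2 m hm).1⟩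

/-- The empty computation. -/
def empty (P : Network k) : Computation P where
  len := 0
  state _ := ⟨∅, P⟩
  label _ := .tau
  contrib _ _ := none
  start := rfl
  step _ hm := absurd hm not_lt_zero

theorem exists_append (C : Computation P) {n : ℕ} (hn : C.len = n) {μ : Action}
    {c : Fin k → Option Action} {S : State k} (h : Step (C.state n) μ c S) :
    ∃ C' : Computation P, C.Extends C' ∧ C'.len = (n + 1 : ℕ) ∧ C'.state (n + 1) = S ∧
      C'.label n = μ ∧ C'.contrib n = c := by
  refine ⟨⟨(n + 1 : ℕ), Function.update C.state (n + 1) S, Function.update C.label n μ,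
    Function.update C.contrib n c, ?_, ?_⟩, ⟨?_, ?_, ?_⟩, rfl, ?_, ?_, ?_⟩
  · rw [Function.update_of_ne (by omega)]
    exact C.start
  · intro m hm
    have hm : m < n + 1 := by exact_mod_cast hm
    rw [Function.update_of_ne (by omega : m ≠ n + 1)]
    by_cases hmn : m = n
    · subst hmn
      simpa using h
    · rw [Function.update_of_ne hmn, Function.update_of_ne hmn,
        Function.update_of_ne (by omega : m + 1 ≠ n + 1)]
      exact C.step m (by rw [hn]; exact_mod_cast (by omega : m < n))
  · exact hn.le.trans (show (n : ℕ∞) ≤ (n + 1 : ℕ) by exact_mod_cast Nat.le_succ n)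
  · intro m hm
    rw [hn] at hm
    have hm : m ≤ n := by exact_mod_cast hm
    exact Function.update_of_ne (by omega) _ _
  · intro m hm
    rw [hn] at hm
    have hm : m < n := by exact_mod_cast hm
    exact ⟨Function.update_of_ne (by omega) _ _, Function.update_of_ne (by omega) _ _⟩
  · exact Function.update_self _ _ _
  · exact Function.update_self _ _ _
  · exact Function.update_self _ _ _

/-- A finite sequence of silent transitions as a computation. -/
theorem exists_of_reflTransGen {S : State k} (h : ReflTransGen Silent ⟨∅, P⟩ S) :
    ∃ (C : Computation P) (n : ℕ), C.len = n ∧ C.state n = S ∧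
      ∀ i n, ¬ C.ProjContains i (.out .o (nodeName (k := k) n)) := by
  induction h with
  | refl =>
    exact ⟨empty P, 0, rfl, rfl, fun i n ⟨m, hm, _⟩ => absurd hm not_lt_zero⟩
  | tail _ h ih =>
    obtain ⟨C, n, hn, rfl, hC⟩ := ih
    obtain ⟨μ, c, hs, hc⟩ := h
    obtain ⟨C', hext, hlen, hstate, _, hcontrib⟩ := C.exists_append hn hs
    refine ⟨C', n + 1, hlen, hstate, fun i l ⟨m, hm, h⟩ => ?_⟩
    rw [hlen] at hm
    have hm : m < n + 1 := by exact_mod_cast hm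
    by_cases hmn : m = n
    · subst hmn
      rw [hcontrib] at h
      exact hc _ _ h l rfl
    · have hm' : (m : ℕ∞) < C.len := by rw [hn]; exact_mod_cast (by omega : m < n)
      rw [(hext.2.2 m hm').2] at h
      exact hC i l ⟨m, hm', h⟩

end Computation

theorem Network.symmetric_start {P : Network k} {ρ : Rotation k}
    (hP : ∀ i, P (ρ.node i) = (P i).map ρ.name) : ρ.Symmetric ⟨∅, P⟩ :=
  ⟨hP, ⟨by simp, by simp, by simp⟩⟩

/-- In an electoral system, every symmetric state that can be reached without declaring a
leader leads to another one. -/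
theorem IsElectoral.exists_next {P : Network k} {ρ : Rotation k} (hk : 0 < k) (hP : IsElectoral P)
    {S : State k} (hr : ReflTransGen Silent ⟨∅, P⟩ S) (hS : ρ.Symmetric S) :
    ∃ S', TransGen Silent S S' ∧ ρ.Symmetric S' := by
  obtain ⟨C, n, hn, rfl, hC⟩ := Computation.exists_of_reflTransGen hr
  -- Otherwise two different leaders could be declared in succession, and no extension of that
  -- computation elects a single one.
  have hcap : ∀ i α Q, Trans ((C.state n).comp i) α Q → NonElecting k α := by
    rintro i α Q h l rfl
    obtain ⟨c, S₁, c', S₂, h₁, h₂⟩ := hS.exists_conflict h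
    obtain ⟨C₁, hext₁, hlen₁, rfl, hlab₁, _⟩ := C.exists_append hn h₁
    obtain ⟨C₂, hext₂, hlen₂, _, hlab₂, _⟩ := C₁.exists_append hlen₁ h₂
    have hc₁ : C₁.Contains (.out .o (nodeName l)) :=
      ⟨n, by rw [hlen₁]; exact_mod_cast Nat.lt_succ_self n, hlab₁⟩
    have hc₂ : C₂.Contains (.out .o (nodeName (ρ.node l))) :=
      ⟨n + 1, by rw [hlen₂]; exact_mod_cast Nat.lt_succ_self (n + 1), hlab₂⟩
    obtain ⟨C', hC', m, _, hm⟩ := hP C₂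
    have hrefl : C'.Extends C' := ⟨le_rfl, fun _ _ => rfl, fun _ _ => ⟨rfl, rfl⟩⟩
    have e₁ := hm C' hrefl _ ((hc₁.of_extends hext₂).of_extends hC')
    have e₂ := hm C' hrefl _ (hc₂.of_extends hC')
    exact ρ.node_ne l (nodeName_injective (e₂.trans e₁.symm))
  -- Nothing is declared so far, so the promised extension has a further transition; whatever it is,
  -- it gives rise to a round.
  obtain ⟨C', hext, m, hproj, _⟩ := hP C
  obtain ⟨p, hp, hc⟩ := hproj ⟨0, hk⟩
  have hlt : (n : ℕ∞) < C'.len := by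
    refine lt_of_le_of_lt ?_ hp
    by_contra hlt
    have hp' : (p : ℕ∞) < C.len := by rw [hn]; exact not_le.1 hlt
    rw [(hext.2.2 p hp').2] at hc
    exact hC _ _ ⟨p, hp', hc⟩
  have hstep := C'.step n hlt
  rw [hext.2.1 n (by rw [hn])] at hstep
  exact hS.exists_round hcap hstep

/-- A network that is symmetric with respect to a rotation is not electoral. -/
theorem Rotation.not_isElectoral {P : Network k} (ρ : Rotation k) (hk : 0 < k)
    (hsym : ∀ i, P (ρ.node i) = (P i).map ρ.name) : ¬ IsElectoral P := by
  intro hP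
  -- States in the middle of a round need not be symmetric; what persists along the run is that a
  -- symmetric state lies ahead.
  let A : State k → Prop := fun S => ReflTransGen Silent ⟨∅, P⟩ S ∧
    ∃ S', ReflTransGen Silent S S' ∧ ρ.Symmetric S'
  have hA : ∀ S : {S // A S}, ∃ S' : {S // A S}, Silent S.1 S'.1 := by
    rintro ⟨S, hr, S', h, hS'⟩
    obtain ⟨S'', h', hS''⟩ : ∃ S'', TransGen Silent S S'' ∧ ρ.Symmetric S'' := by
      obtain ⟨S'', h', hS''⟩ := hP.exists_next hk (hr.trans h) hS'
      exact ⟨S'', TransGen.trans_right h h', hS''⟩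
    obtain ⟨T, hT, hT'⟩ := TransGen.head'_iff.1 h'
    exact ⟨⟨T, hr.tail hT, S'', hT', hS''⟩, hT⟩
  choose next hnext using hA
  let seq : ℕ → {S // A S} := fun n =>
    next^[n] ⟨⟨∅, P⟩, .refl, _, .refl, Network.symmetric_start hsym⟩
  have hseq : ∀ n, Silent (seq n).1 (seq (n + 1)).1 := fun n => by
    simp only [seq, Function.iterate_succ_apply']
    exact hnext _
  choose μ c hstep hc using hseq
  let C : Computation P := ⟨⊤, fun n => (seq n).1, μ, c, rfl, fun m _ => hstep m⟩
  obtain ⟨C', hext, n, hproj, _⟩ := hP C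
  obtain ⟨m, _, h⟩ := hproj ⟨0, hk⟩
  -- The run is infinite, so its extension has the same contributions throughout.
  rw [(hext.2.2 m (ENat.natCast_lt_top m)).2] at h
  exact hc m _ _ h n rfl

end AsyncPi

theorem mainTheorem2 (k : ℕ) (P : AsyncPi.Network k) (σ : P.hypergraph.Aut)
    (hbal : σ.WellBalanced) (hne : σ ≠ AsyncPi.Hypergraph.Aut.id P.hypergraph)
    (hid : P.RespectsIdentifiers σ) (hsym : P.SymmetricWrt σ) :
    ¬ AsyncPi.IsElectoral P := by
  obtain ⟨ρ, hρ⟩ := AsyncPi.Network.exists_rotation hbal hne hid hsym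
  have hk : 0 < k := by
    rcases Nat.eq_zero_or_pos k with rfl | hk
    -- Without nodes the permutation of the nodes is trivial, which a nontrivial symmetry excludes.
    · exact absurd (Equiv.ext fun i : Fin 0 => i.elim0) (AsyncPi.Network.onN_ne_one hne hsym)
    · exact hk
  exact ρ.not_isElectoral hk hρ
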